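/- Let $\mathcal K$ be a real Hilbert space with inner product $\cdot$, and let $\Omega$ be a (possibly unbounded) positive self-adjoint operator on $\mathcal K$ with trivial kernel. Real functions $f(\Omega)$ are defined by the functional calculus. For $\lambda\in\mathbb R$ let $\mathcal K_\lambda$ be the completion of the domain of $\Omega^\lambda$ in the norm $\|\Omega^\lambda q\|$, and let $\mathcal H=\mathcal K_{1/2}\oplus\mathcal K_{-1/2}$ (a real Hilbert space), with elements $X=(q,p)$. Operators such as $\Omega^{\pm1/2}:\mathcal K_{\pm1/2}\to\mathcal K$, $\Omega:\mathcal K_{1/2}\to\mathcal K_{-1/2}$, $\Omega^{-1}:\mathcal K_{-1/2}\to\mathcal K_{1/2}$, and $\cos\Omega t,\ \sin\Omega t$ on $\mathcal K_{\pm1/2}$, are understood as extended by continuity. Put, for $X=(q,p)$, $X'=(q',p')$ in $\mathcal H$ and $t\in\mathbb R$, $$J(q,p)=(-\Omega^{-1}p,\ \Omega q),\qquad s(X,X')=\Omega^{1/2}q\cdot\Omega^{-1/2}p'-\Omega^{1/2}q'\cdot\Omega^{-1/2}p,\qquad g_\Omega(X,X')=s(X,JX'),$$ $$\langle X,X'\rangle_+=\tfrac12\bigl(g_\Omega(X,X')+i\,s(X,X')\bigr),\qquad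 \Phi_t=\cos(\Omega t)-\sin(\Omega t)\,J .$$ Let $\mathcal K^{\mathbb C}=\mathcal K\oplus i\mathcal K$ be the complexification of $\mathcal K$, with inner product $\langle z,z'\rangle=\overline z\cdot z'$ ($\cdot$ being extended bilinearly), let $e^{-i\Omega t}$ be the unitary group generated by the complexification of $\Omega$, and define $$z_\Omega:\mathcal H\to\mathcal K^{\mathbb C},\qquad z_\Omega(q,p)=\tfrac1{\sqrt2}\bigl(\Omega^{1/2}q+i\,\Omega^{-1/2}p\bigr).$$ Then $J^2=-1$, $s(JX,JX')=s(X,X')$ for all $X,X'\in\mathcal H$, and $s(X,JX)>0$ for all $X\neq0$; the space $\mathcal H$, with multiplication by complex numbers $(a+ib)X=aX+bJX$ and inner product $\langle\cdot,\cdot\rangle_+$, is a complex Hilbert space; and $z_\Omega$ is a unitary isomorphism (complex linear, surjective, isometric) from $(\mathcal H,J,\langle\cdot,\cdot\rangle_+)$ onto $\mathcal K^{\mathbb C}$. More precisely, for all $X,X'\in\mathcal H$ and $t\in\mathbb R$, $$z_\Omega(JX)=i\,z_\Omega(X),\qquad \overline{z_\Omega(X)}\cdot z_\Omega(X')=\langle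 X,X'\rangle_+,\qquad z_\Omega(\Phi_tX)=e^{-i\Omega t}z_\Omega(X).$$ -/

import Mathlib

noncomputable section

namespace OscillatorField

open scoped ComplexConjugate

/-! ### Complexification of a real Hilbert space -/

/-- The complexification `K ⊕ iK` of a real Hilbert space `K`; the pair `(x, y)` stands for
`x + iy`. -/
def Complexification (K : Type*) : Type _ := WithLp 2 (K × K)

namespace Complexification

variable {K : Type*}

/-- The element `x + iy`. -/
def mk (x y : K) : Complexification K := WithLp.toLp 2 (x, y)

/-- The real part of an element of the complexification. -/
def re (z : Complexification K) : K := (WithLp.ofLp z).1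

/-- The imaginary part of an element of the complexification. -/
def im (z : Complexification K) : K := (WithLp.ofLp z).2

@[simp] theorem re_mk (x y : K) : (mk x y).re = x := rfl

@[simp] theorem im_mk (x y : K) : (mk x y).im = y := rfl

@[ext] theorem ext {z w : Complexification K} (h₁ : z.re = w.re) (h₂ : z.im = w.im) : z = w :=
  (WithLp.equiv 2 (K × K)).injective (Prod.ext h₁ h₂)

variable [NormedAddCommGroup K]

instance : NormedAddCommGroup (Complexification K) :=
  inferInstanceAs (NormedAddCommGroup (WithLp 2 (K × K)))

instance [CompleteSpace K] : CompleteSpace (Complexification K) :=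
  inferInstanceAs (CompleteSpace (WithLp 2 (K × K)))

@[simp] theorem re_zero : (0 : Complexification K).re = 0 := rfl

@[simp] theorem im_zero : (0 : Complexification K).im = 0 := rfl

@[simp] theorem re_add (z w : Complexification K) : (z + w).re = z.re + w.re := rfl

@[simp] theorem im_add (z w : Complexification K) : (z + w).im = z.im + w.im := rfl

theorem norm_sq_eq (z : Complexification K) : ‖z‖ ^ 2 = ‖z.re‖ ^ 2 + ‖z.im‖ ^ 2 :=
  WithLp.prod_norm_sq_eq_of_L2 (α := K) (β := K) z

variable [InnerProductSpace ℝ K]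

instance : SMul ℂ (Complexification K) :=
  ⟨fun c z => mk (c.re • z.re - c.im • z.im) (c.re • z.im + c.im • z.re)⟩

@[simp] theorem re_smul (c : ℂ) (z : Complexification K) :
    (c • z).re = c.re • z.re - c.im • z.im := rfl

@[simp] theorem im_smul (c : ℂ) (z : Complexification K) :
    (c • z).im = c.re • z.im + c.im • z.re := rfl

instance : Module ℂ (Complexification K) where
  one_smul z := by ext <;> simp
  mul_smul a b z := by
    ext
    · simp only [re_smul, im_smul, Complex.mul_re, Complex.mul_im]; module
    · simp only [re_smul, im_smul, Complex.mul_re, Complex.mul_im]; module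
  smul_zero a := by ext <;> simp
  smul_add a z w := by
    ext
    · simp only [re_smul, re_add, im_add]; module
    · simp only [im_smul, re_add, im_add]; module
  add_smul a b z := by
    ext
    · simp only [re_smul, re_add, Complex.add_re, Complex.add_im]; module
    · simp only [im_smul, im_add, Complex.add_re, Complex.add_im]; module
  zero_smul z := by ext <;> simp

/-- The inner product `z̄ · w`, where the inner product `·` of `K` is extended to be complex
bilinear. -/
instance : Inner ℂ (Complexification K) :=
  ⟨fun z w => ⟨inner ℝ z.re w.re + inner ℝ z.im w.im, inner ℝ z.re w.im - inner ℝ z.im w.re⟩⟩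

theorem inner_def (z w : Complexification K) :
    inner ℂ z w =
      ⟨inner ℝ z.re w.re + inner ℝ z.im w.im, inner ℝ z.re w.im - inner ℝ z.im w.re⟩ := rfl

theorem norm_smul_sq (c : ℂ) (z : Complexification K) : ‖c • z‖ ^ 2 = (‖c‖ * ‖z‖) ^ 2 := by
  rw [mul_pow, norm_sq_eq, norm_sq_eq, Complex.sq_norm, Complex.normSq_apply, re_smul, im_smul,
    norm_sub_sq_real, norm_add_sq_real]
  simp only [norm_smul, mul_pow, Real.norm_eq_abs, sq_abs, real_inner_smul_left,
    real_inner_smul_right, real_inner_comm z.re z.im]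
  ring

instance : InnerProductSpace ℂ (Complexification K) where
  norm_smul_le c z := by
    have h := norm_smul_sq c z
    exact le_of_eq ((sq_eq_sq₀ (norm_nonneg _) (by positivity)).mp h)
  norm_sq_eq_re_inner z := by
    rw [norm_sq_eq, inner_def]
    simp
  conj_inner_symm z w := by
    apply Complex.ext
    · simp [inner_def, real_inner_comm]
    · simp [inner_def, real_inner_comm]
  add_left z₁ z₂ w := by
    apply Complex.ext
    · simp only [inner_def, re_add, im_add, inner_add_left, Complex.add_re]; ring
    · simp only [inner_def, re_add, im_add, inner_add_left, Complex.add_im]; ring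
  smul_left z w c := by
    apply Complex.ext
    · simp only [inner_def, re_smul, im_smul, inner_add_left, inner_sub_left, real_inner_smul_left,
        Complex.mul_re, Complex.conj_re, Complex.conj_im]
      ring
    · simp only [inner_def, re_smul, im_smul, inner_add_left, inner_sub_left, real_inner_smul_left,
        Complex.mul_im, Complex.conj_re, Complex.conj_im]
      ring

/-- The inclusion `x ↦ x + i0` of `K` into its complexification. -/
def ofReal : K →ₗ[ℝ] Complexification K where
  toFun x := mk x 0
  map_add' x y := by ext <;> simp
  map_smul' r x := by
    change mk (r • x) 0 = (r : ℂ) • mk x 0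
    apply ext
    · rw [re_smul]; simp
    · rw [im_smul]; simp

end Complexification

/-- The complexification of an operator:
`x + iy ↦ A x + i A y` for `x, y` in the domain of `A`. -/
def complexify {K : Type*} [NormedAddCommGroup K] [InnerProductSpace ℝ K] (A : K →ₗ.[ℝ] K) :
    Complexification K →ₗ.[ℂ] Complexification K where
  domain :=
    { carrier := {z | z.re ∈ A.domain ∧ z.im ∈ A.domain}
      zero_mem' := ⟨A.domain.zero_mem, A.domain.zero_mem⟩
      add_mem' := fun hz hw => ⟨A.domain.add_mem hz.1 hw.1, A.domain.add_mem hz.2 hw.2⟩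
      smul_mem' := fun c _ hz =>
        ⟨A.domain.sub_mem (A.domain.smul_mem c.re hz.1) (A.domain.smul_mem c.im hz.2),
          A.domain.add_mem (A.domain.smul_mem c.re hz.2) (A.domain.smul_mem c.im hz.1)⟩ }
  toFun :=
    { toFun := fun z =>
        Complexification.mk (A ⟨z.1.re, z.2.1⟩) (A ⟨z.1.im, z.2.2⟩)
      map_add' := fun z w => by
        apply Complexification.ext
        · exact A.map_add ⟨z.1.re, z.2.1⟩ ⟨w.1.re, w.2.1⟩
        · exact A.map_add ⟨z.1.im, z.2.2⟩ ⟨w.1.im, w.2.2⟩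
      map_smul' := fun c z => by
        apply Complexification.ext
        · have h := A.map_sub (c.re • ⟨z.1.re, z.2.1⟩) (c.im • ⟨z.1.im, z.2.2⟩)
          rw [A.map_smul, A.map_smul] at h
          exact h
        · have h := A.map_add (c.re • ⟨z.1.im, z.2.2⟩) (c.im • ⟨z.1.re, z.2.1⟩)
          rw [A.map_smul, A.map_smul] at h
          exact h }

/-! ### Functional calculus

For a positive self-adjoint operator `A` with trivial kernel and a function `f` that is continuous
on `(0, ∞)`, the (in general unbounded) operator `f(A)` of the spectral theorem is built from the
bounded continuous functional calculus of the resolvent `(1 + A)⁻¹`. -/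

section FunctionalCalculus

variable {E : Type*} [NormedAddCommGroup E] [InnerProductSpace ℂ E]

/-- `R` is a bounded two-sided inverse of `1 + A`. -/
def IsInverseOneAdd (A : E →ₗ.[ℂ] E) (R : E →L[ℂ] E) : Prop :=
  (∀ x : A.domain, R (x + A x) = x) ∧
    ∀ y : E, ∃ x : A.domain, (x : E) = R y ∧ (x : E) + A x = y

open scoped Classical in
/-- The bounded operator `(1 + A)⁻¹` (and `0` if `1 + A` has no bounded inverse). -/
def inverseOneAdd (A : E →ₗ.[ℂ] E) : E →L[ℂ] E :=
  if h : ∃ R : E →L[ℂ] E, IsInverseOneAdd A R then h.choose else 0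

/-- Continuous functions on the line whose support is a compact subset of `(0, ∞)`. -/
def IsCutoff (g : ℝ → ℝ) : Prop :=
  Continuous g ∧ HasCompactSupport g ∧ tsupport g ⊆ Set.Ioi 0

variable [CompleteSpace E]

/-- The bounded operator `g(A)` for a function `g` that is continuous with compact support in
`(0, ∞)`: the spectral variables of `A` and of `R = (1 + A)⁻¹` are related by `ω = r⁻¹ - 1`, and
`r ↦ g (r⁻¹ - 1)` is continuous. -/
def cutoffOp (A : E →ₗ.[ℂ] E) (g : ℝ → ℂ) : E →L[ℂ] E :=
  cfc (fun r : ℂ => g (r.re⁻¹ - 1)) (inverseOneAdd A)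

/-- The graph of `f(A)`: the pairs `(x, y)` such that `g(A) y = (g f)(A) x` for all cutoff
functions `g`. In a spectral representation this says that `y = f x` almost everywhere on
`(0, ∞)`, so that `x` belongs to the domain if and only if `f x` is square integrable. -/
def functionGraph (A : E →ₗ.[ℂ] E) (f : ℝ → ℂ) : Submodule ℂ (E × E) where
  carrier := {p | ∀ g : ℝ → ℝ, IsCutoff g →
    cutoffOp A (fun ω => (g ω : ℂ)) p.2 = cutoffOp A (fun ω => (g ω : ℂ) * f ω) p.1}
  zero_mem' := fun g _ => by simp
  add_mem' := fun hp hq g hg => by simp [hp g hg, hq g hg]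
  smul_mem' := fun c p hp g hg => by simp [hp g hg]

/-- The operator `f(A)` on a complex Hilbert space. -/
def functionOf (A : E →ₗ.[ℂ] E) (f : ℝ → ℂ) : E →ₗ.[ℂ] E :=
  (functionGraph A f).toLinearPMap

end FunctionalCalculus

section RealHilbert

variable {K : Type*} [NormedAddCommGroup K] [InnerProductSpace ℝ K] [CompleteSpace K]

/-- The operator `f(Ω)` on the real Hilbert space `K`, for a real function `f`: the restriction to
`K` of the operator `f(Ω)` on the complexification. -/
def realFunctionOf (Ω : K →ₗ.[ℝ] K) (f : ℝ → ℝ) : K →ₗ.[ℝ] K :=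
  (((functionGraph (complexify Ω) (fun ω => (f ω : ℂ))).restrictScalars ℝ).comap
    (Complexification.ofReal.prodMap Complexification.ofReal)).toLinearPMap

/-- The power `Ω ^ lam`. -/
def power (Ω : K →ₗ.[ℝ] K) (lam : ℝ) : K →ₗ.[ℝ] K :=
  realFunctionOf Ω (fun ω => ω ^ lam)

/-! ### The scale of spaces and the phase space -/

/-- The domain of `Ω ^ lam`, with the norm `‖Ω ^ lam q‖`. -/
def PreScale (Ω : K →ₗ.[ℝ] K) (lam : ℝ) : Type _ := (power Ω lam).domain

instance (Ω : K →ₗ.[ℝ] K) (lam : ℝ) : AddCommGroup (PreScale Ω lam) :=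
  inferInstanceAs (AddCommGroup (power Ω lam).domain)

instance (Ω : K →ₗ.[ℝ] K) (lam : ℝ) : Module ℝ (PreScale Ω lam) :=
  inferInstanceAs (Module ℝ (power Ω lam).domain)

/-- The operator `Ω ^ lam` on its domain. -/
def PreScale.pow (Ω : K →ₗ.[ℝ] K) (lam : ℝ) : PreScale Ω lam →ₗ[ℝ] K :=
  (power Ω lam).toFun

instance (Ω : K →ₗ.[ℝ] K) (lam : ℝ) : SeminormedAddCommGroup (PreScale Ω lam) :=
  SeminormedAddCommGroup.induced (PreScale Ω lam) K (PreScale.pow Ω lam)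

instance (Ω : K →ₗ.[ℝ] K) (lam : ℝ) : InnerProductSpace ℝ (PreScale Ω lam) where
  norm_smul_le c x := by
    change ‖PreScale.pow Ω lam (c • x)‖ ≤ ‖c‖ * ‖PreScale.pow Ω lam x‖
    rw [map_smul, norm_smul]
  inner x y := inner ℝ (PreScale.pow Ω lam x) (PreScale.pow Ω lam y)
  norm_sq_eq_re_inner x := by
    change ‖PreScale.pow Ω lam x‖ ^ 2 = _
    simp
  conj_inner_symm x y := by simp [real_inner_comm]
  add_left x y z := by simp [inner_add_left]
  smul_left x y c := by simp [real_inner_smul_left]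

/-- The Hilbert space `K_lam`: the completion of the domain of `Ω ^ lam` in the norm
`‖Ω ^ lam q‖`. -/
abbrev Scale (Ω : K →ₗ.[ℝ] K) (lam : ℝ) : Type _ := UniformSpace.Completion (PreScale Ω lam)

/-- The canonical map from the domain of `Ω ^ lam` into `K_lam`. -/
def toScale (Ω : K →ₗ.[ℝ] K) (lam : ℝ) : (power Ω lam).domain →ₗ[ℝ] Scale Ω lam :=
  (UniformSpace.Completion.toComplL (𝕜 := ℝ) (E := PreScale Ω lam)).toLinearMap

/-- The operator `Ω ^ lam : K_lam → K`, extended by continuity from the domain of `Ω ^ lam`. -/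
def scalePower (Ω : K →ₗ.[ℝ] K) (lam : ℝ) : Scale Ω lam →L[ℝ] K :=
  (power Ω lam).toFun.extendOfNorm (toScale Ω lam)

/-- The pairs `(x, T x)` with `x` in the domain of `Ω ^ lam` and `T x` in the domain of
`Ω ^ mu`. -/
def scaleCore (Ω T : K →ₗ.[ℝ] K) (lam mu : ℝ) : Submodule ℝ (K × K) :=
  T.graph ⊓ (power Ω lam).domain.prod (power Ω mu).domain

/-- The extension by continuity of an operator `T` on `K` to a bounded operator
`K_lam → K_mu`. -/
def scaleExtend (Ω T : K →ₗ.[ℝ] K) (lam mu : ℝ) : Scale Ω lam →L[ℝ] Scale Ω mu :=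
  ((toScale Ω mu).comp
      ((LinearMap.snd ℝ K K).restrict (p := scaleCore Ω T lam mu) (q := (power Ω mu).domain)
        fun _ hp => hp.2.2)).extendOfNorm
    ((toScale Ω lam).comp
      ((LinearMap.fst ℝ K K).restrict (p := scaleCore Ω T lam mu) (q := (power Ω lam).domain)
        fun _ hp => hp.2.1))

/-- The real phase space `K_{1/2} ⊕ K_{-1/2}`, with its natural Hilbert space structure. -/
abbrev PhaseSpace (Ω : K →ₗ.[ℝ] K) : Type _ :=
  WithLp 2 (Scale Ω (1 / 2) × Scale Ω (-(1 / 2)))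

/-- The linear map `(q, p) ↦ √Ω q`. -/
def sqrtQ (Ω : K →ₗ.[ℝ] K) : PhaseSpace Ω →ₗ[ℝ] K where
  toFun X := scalePower Ω (1 / 2) X.fst
  map_add' X Y := by simp
  map_smul' r X := by simp

/-- The linear map `(q, p) ↦ (√Ω)⁻¹ p`. -/
def invSqrtP (Ω : K →ₗ.[ℝ] K) : PhaseSpace Ω →ₗ[ℝ] K where
  toFun X := scalePower Ω (-(1 / 2)) X.snd
  map_add' X Y := by simp
  map_smul' r X := by simp

/-- The symplectic form `s(X, X') = √Ω q · (√Ω)⁻¹ p' - √Ω q' · (√Ω)⁻¹ p`. -/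
def symplecticForm (Ω : K →ₗ.[ℝ] K) (X Y : PhaseSpace Ω) : ℝ :=
  inner ℝ (sqrtQ Ω X) (invSqrtP Ω Y) - inner ℝ (sqrtQ Ω Y) (invSqrtP Ω X)

/-- The operator `J (q, p) = (-Ω⁻¹ p, Ω q)`. -/
def complexStructure (Ω : K →ₗ.[ℝ] K) : PhaseSpace Ω →ₗ[ℝ] PhaseSpace Ω where
  toFun X := WithLp.toLp 2
    (-scaleExtend Ω Ω.inverse (-(1 / 2)) (1 / 2) X.snd,
      scaleExtend Ω Ω (1 / 2) (-(1 / 2)) X.fst)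
  map_add' X Y := by
    simp only [WithLp.add_snd, WithLp.add_fst, _root_.map_add, neg_add]
    rfl
  map_smul' r X := by
    simp only [WithLp.smul_snd, WithLp.smul_fst, _root_.map_smul, ← smul_neg]
    rfl

/-- The form `g(X, Y) = s(X, J Y)`. -/
def metricForm (Ω : K →ₗ.[ℝ] K) (X Y : PhaseSpace Ω) : ℝ :=
  symplecticForm Ω X (complexStructure Ω Y)

/-- The form `⟨X, Y⟩₊ = (g(X, Y) + i s(X, Y)) / 2`. -/
def innerPlus (Ω : K →ₗ.[ℝ] K) (X Y : PhaseSpace Ω) : ℂ :=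
  (1 / 2) * ((metricForm Ω X Y : ℂ) + Complex.I * (symplecticForm Ω X Y : ℂ))

/-- The operator `f(Ω) ⊕ f(Ω)` on the phase space, `f` being a bounded function. -/
def diagonalOp (Ω : K →ₗ.[ℝ] K) (f : ℝ → ℝ) (X : PhaseSpace Ω) : PhaseSpace Ω :=
  WithLp.toLp 2
    (scaleExtend Ω (realFunctionOf Ω f) (1 / 2) (1 / 2) X.fst,
      scaleExtend Ω (realFunctionOf Ω f) (-(1 / 2)) (-(1 / 2)) X.snd)

/-- The classical flow `Φ_t = cos(Ωt) - sin(Ωt) J`. -/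
def classicalFlow (Ω : K →ₗ.[ℝ] K) (t : ℝ) (X : PhaseSpace Ω) : PhaseSpace Ω :=
  diagonalOp Ω (fun ω => Real.cos (ω * t)) X -
    diagonalOp Ω (fun ω => Real.sin (ω * t)) (complexStructure Ω X)

/-- The map `z(q, p) = (√Ω q + i (√Ω)⁻¹ p) / √2` into the complexification of `K`. -/
def zMap (Ω : K →ₗ.[ℝ] K) (X : PhaseSpace Ω) : Complexification K :=
  ((1 / Real.sqrt 2 : ℝ) : ℂ) •
    (Complexification.ofReal (sqrtQ Ω X) + Complex.I • Complexification.ofReal (invSqrtP Ω X))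

/-- The operator `e^{-iΩt}` on the complexification of `K`. -/
def unitaryGroup (Ω : K →ₗ.[ℝ] K) (t : ℝ) : Complexification K →ₗ.[ℂ] Complexification K :=
  functionOf (complexify Ω) (fun ω => Complex.exp (-(Complex.I * ω * t)))

/-! ### The complex Hilbert space `(H, J, ⟨·,·⟩₊)` -/

/-- `J` is a complex structure on the phase space that is compatible with the symplectic form and
positive definite. -/
structure IsPositiveComplexStructure (Ω : K →ₗ.[ℝ] K) : Prop where
  sq : ∀ X, complexStructure Ω (complexStructure Ω X) = -X
  symplectic : ∀ X Y,
    symplecticForm Ω (complexStructure Ω X) (complexStructure Ω Y) = symplecticForm Ω X Y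
  pos : ∀ X, X ≠ 0 → 0 < symplecticForm Ω X (complexStructure Ω X)

theorem symplecticForm_swap (Ω : K →ₗ.[ℝ] K) (X Y : PhaseSpace Ω) :
    symplecticForm Ω Y X = -symplecticForm Ω X Y := by
  simp [symplecticForm]

theorem symplecticForm_add_left (Ω : K →ₗ.[ℝ] K) (X Y Z : PhaseSpace Ω) :
    symplecticForm Ω (X + Y) Z = symplecticForm Ω X Z + symplecticForm Ω Y Z := by
  simp only [symplecticForm, map_add, inner_add_left, inner_add_right]
  ring

theorem symplecticForm_smul_left (Ω : K →ₗ.[ℝ] K) (r : ℝ) (X Y : PhaseSpace Ω) :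
    symplecticForm Ω (r • X) Y = r * symplecticForm Ω X Y := by
  simp only [symplecticForm, map_smul, real_inner_smul_left, real_inner_smul_right]
  ring

theorem symplecticForm_neg_left (Ω : K →ₗ.[ℝ] K) (X Y : PhaseSpace Ω) :
    symplecticForm Ω (-X) Y = -symplecticForm Ω X Y := by
  rw [← neg_one_smul ℝ X, symplecticForm_smul_left, neg_one_mul]

theorem metricForm_comm {Ω : K →ₗ.[ℝ] K} (hΩ : IsPositiveComplexStructure Ω)
    (X Y : PhaseSpace Ω) : metricForm Ω Y X = metricForm Ω X Y := by
  rw [metricForm, metricForm, ← hΩ.symplectic Y (complexStructure Ω X), hΩ.sq,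
    symplecticForm_swap Ω (-X), symplecticForm_neg_left, neg_neg]

theorem re_innerPlus (Ω : K →ₗ.[ℝ] K) (X Y : PhaseSpace Ω) :
    (innerPlus Ω X Y).re = 1 / 2 * metricForm Ω X Y := by
  simp [innerPlus]

theorem im_innerPlus (Ω : K →ₗ.[ℝ] K) (X Y : PhaseSpace Ω) :
    (innerPlus Ω X Y).im = 1 / 2 * symplecticForm Ω X Y := by
  simp [innerPlus]

/-- The phase space, as a complex vector space in which multiplication by `i` is `J`. -/
def ComplexPhaseSpace (Ω : K →ₗ.[ℝ] K) (_ : IsPositiveComplexStructure Ω) : Type _ := PhaseSpace Ω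

namespace ComplexPhaseSpace

variable {Ω : K →ₗ.[ℝ] K} (hΩ : IsPositiveComplexStructure Ω)

/-- A point of the phase space, viewed in the complex Hilbert space. -/
def of (X : PhaseSpace Ω) : ComplexPhaseSpace Ω hΩ := X

instance : AddCommGroup (ComplexPhaseSpace Ω hΩ) := inferInstanceAs (AddCommGroup (PhaseSpace Ω))

/-- Multiplication by complex numbers: `(a + ib) X = a X + b J X`. -/
instance : Module ℂ (ComplexPhaseSpace Ω hΩ) where
  smul c := fun X : PhaseSpace Ω => of hΩ (c.re • X + c.im • complexStructure Ω X)
  one_smul := fun X : PhaseSpace Ω => by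
    change (1 : ℝ) • X + (0 : ℝ) • complexStructure Ω X = X
    simp
  mul_smul a b := fun X : PhaseSpace Ω => by
    change (a * b).re • X + (a * b).im • complexStructure Ω X =
      a.re • (b.re • X + b.im • complexStructure Ω X) +
        a.im • complexStructure Ω (b.re • X + b.im • complexStructure Ω X)
    rw [_root_.map_add, _root_.map_smul, _root_.map_smul, hΩ.sq, Complex.mul_re, Complex.mul_im]
    module
  smul_zero a := by
    change a.re • (0 : PhaseSpace Ω) + a.im • complexStructure Ω 0 = 0
    simp
  smul_add a := fun X Y : PhaseSpace Ω => by
    change a.re • (X + Y) + a.im • complexStructure Ω (X + Y) =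
      (a.re • X + a.im • complexStructure Ω X) + (a.re • Y + a.im • complexStructure Ω Y)
    rw [_root_.map_add]
    module
  add_smul a b := fun X : PhaseSpace Ω => by
    change (a + b).re • X + (a + b).im • complexStructure Ω X =
      (a.re • X + a.im • complexStructure Ω X) + (b.re • X + b.im • complexStructure Ω X)
    rw [Complex.add_re, Complex.add_im]
    module
  zero_smul := fun X : PhaseSpace Ω => by
    change (0 : ℝ) • X + (0 : ℝ) • complexStructure Ω X = 0
    simp

/-- The form `⟨·,·⟩₊` is a complex inner product for the complex structure `J`. -/
abbrev innerCore : InnerProductSpace.Core ℂ (ComplexPhaseSpace Ω hΩ) where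
  inner := fun X Y : PhaseSpace Ω => innerPlus Ω X Y
  conj_inner_symm := fun X Y : PhaseSpace Ω => by
    change conj (innerPlus Ω Y X) = innerPlus Ω X Y
    have h₁ := symplecticForm_swap Ω X Y
    have h₂ := metricForm_comm hΩ X Y
    rw [innerPlus, innerPlus, h₁, h₂]
    apply Complex.ext <;> simp
  re_inner_nonneg := fun X : PhaseSpace Ω => by
    change 0 ≤ (innerPlus Ω X X).re
    rw [re_innerPlus]
    rcases eq_or_ne X 0 with rfl | hX
    · simp [metricForm, symplecticForm]
    · have h := hΩ.pos X hX
      rw [metricForm]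
      positivity
  add_left := fun X Y Z : PhaseSpace Ω => by
    change innerPlus Ω (X + Y) Z = innerPlus Ω X Z + innerPlus Ω Y Z
    simp only [innerPlus, metricForm, symplecticForm_add_left]
    push_cast
    ring
  smul_left := fun (X Y : PhaseSpace Ω) c => by
    change innerPlus Ω (c.re • X + c.im • complexStructure Ω X) Y = conj c * innerPlus Ω X Y
    have h : symplecticForm Ω (complexStructure Ω X) Y = -metricForm Ω X Y := by
      have h := hΩ.symplectic (complexStructure Ω X) Y
      rw [hΩ.sq, symplecticForm_neg_left] at h
      rw [metricForm, ← h]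
    apply Complex.ext
    · simp only [re_innerPlus, im_innerPlus, metricForm, symplecticForm_add_left,
        symplecticForm_smul_left, hΩ.symplectic, Complex.mul_re, Complex.conj_re,
        Complex.conj_im]
      ring
    · simp only [re_innerPlus, im_innerPlus, symplecticForm_add_left,
        symplecticForm_smul_left, h, Complex.mul_im, Complex.conj_re, Complex.conj_im]
      ring
  definite := fun (X : PhaseSpace Ω) hX => by
    by_contra hne
    have h := hΩ.pos X hne
    have h' := congrArg Complex.re hX
    change (innerPlus Ω X X).re = 0 at h'
    rw [re_innerPlus, metricForm] at h'
    linarith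

instance : NormedAddCommGroup (ComplexPhaseSpace Ω hΩ) := (innerCore hΩ).toNormedAddCommGroup

instance : InnerProductSpace ℂ (ComplexPhaseSpace Ω hΩ) :=
  InnerProductSpace.ofCore (innerCore hΩ).toCore

end ComplexPhaseSpace

end RealHilbert

end OscillatorField

end

namespace OscillatorField

open Complexification

/-! ### The resolvent of a positive self-adjoint operator -/

section Resolvent

variable {K : Type*} [NormedAddCommGroup K] [InnerProductSpace ℝ K]

/-! The isometries `Ω^{1/2}` and `Ω^{-1/2}` carry `K_{1/2}` and `K_{-1/2}` onto `K`. In the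
coordinates `u = Ω^{1/2} q`, `v = Ω^{-1/2} p` the phase space becomes `K ⊕ K`, `J` becomes `(u, v) ↦
(-v, u)`, `s` becomes `u · v' - u' · v`, and `g` becomes `u · u' + v · v'`. All the algebraic claims
are then those of multiplication by `i` on `u + iv`, and the flow is `cos(Ωt) - i sin(Ωt)` split
into real and imaginary parts.

The analytic work is to show that the operators extended by continuity really have this form.
`scaleExtend_mem_graph` does so: an extension of `f(Ω)` from `K_lam` to `K_mu` acts in these
coordinates as the bounded multiplier `ω^mu f(ω) ω^(-lam)`. For `Ω` and `Ω⁻¹` in `J` this multiplier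
is `1`; for `cos` and `sin` it is the function itself. `scalePower_surjective` makes the coordinates
onto.

These rest on a calculus for unbounded `f(Ω)` in which an identity is tested against cutoffs `g(Ω)`,
continuous functions of the bounded operator `R = (1 + Ω)⁻¹` (`exists_isResolvent`). The tests
suffice because `0` and `1` are not eigenvalues of `R`, so cutoffs approximate the identity strongly
(`exists_cutoffCfc_sub_lt`). The product rule `mem_graph_mul_iff` follows since a cutoff times a
function continuous on `(0, ∞)` is again a cutoff. -/

theorem inner_graph_nonneg {Ω : K →ₗ.[ℝ] K} (hpos : ∀ x : Ω.domain, 0 ≤ inner ℝ (x : K) (Ω x))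
    {a b : K} (hab : (a, b) ∈ Ω.graph) : 0 ≤ inner ℝ a b := by
  obtain ⟨x, rfl, rfl⟩ := (LinearPMap.mem_graph_iff _).mp hab
  exact hpos x

/-- A bounded everywhere defined operator is the inverse of `1 + Ω`, expressed through the graph
of `Ω`. -/
def IsResolvent (Ω : K →ₗ.[ℝ] K) (R : K →L[ℝ] K) : Prop :=
  ∀ a b, (a, b) ∈ Ω.graph ↔ R (a + b) = a

theorem IsResolvent.mem_graph {Ω : K →ₗ.[ℝ] K} {R : K →L[ℝ] K} (hR : IsResolvent Ω R) (y : K) :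
    (R y, y - R y) ∈ Ω.graph := (hR _ _).mpr (by simp)

/-- The complexification of a bounded operator. -/
noncomputable def complexifyCLM (B : K →L[ℝ] K) : Complexification K →L[ℂ] Complexification K :=
  LinearMap.mkContinuous
    { toFun := fun z => mk (B z.re) (B z.im)
      map_add' := fun z w => by ext <;> simp
      map_smul' := fun c z => by ext <;> simp } ‖B‖ fun z => by
    refine (sq_le_sq₀ (norm_nonneg _) (by positivity)).mp ?_
    rw [mul_pow, norm_sq_eq, norm_sq_eq, mul_add]
    have h : ∀ x, ‖B x‖ ^ 2 ≤ ‖B‖ ^ 2 * ‖x‖ ^ 2 := fun x => by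
      rw [← mul_pow]
      exact pow_le_pow_left₀ (norm_nonneg _) (B.le_opNorm x) 2
    exact add_le_add (h _) (h _)

@[simp] theorem complexifyCLM_re (B : K →L[ℝ] K) (z : Complexification K) :
    (complexifyCLM B z).re = B z.re := rfl

@[simp] theorem complexifyCLM_im (B : K →L[ℝ] K) (z : Complexification K) :
    (complexifyCLM B z).im = B z.im := rfl

theorem norm_complexifyCLM_le (B : K →L[ℝ] K) : ‖complexifyCLM B‖ ≤ ‖B‖ :=
  LinearMap.mkContinuous_norm_le _ (norm_nonneg _) _

theorem complexify_graph_iff (A : K →ₗ.[ℝ] K) (z w : Complexification K) :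
    (z, w) ∈ (complexify A).graph ↔ (z.re, w.re) ∈ A.graph ∧ (z.im, w.im) ∈ A.graph := by
  simp only [LinearPMap.mem_graph_iff]
  constructor
  · rintro ⟨x, rfl, rfl⟩
    exact ⟨⟨⟨x.1.re, x.2.1⟩, rfl, rfl⟩, ⟨⟨x.1.im, x.2.2⟩, rfl, rfl⟩⟩
  · rintro ⟨⟨x, hx, hx'⟩, ⟨y, hy, hy'⟩⟩
    refine ⟨⟨z, ?_, ?_⟩, rfl, ?_⟩
    · exact hx ▸ x.2
    · exact hy ▸ y.2
    · apply Complexification.ext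
      · exact (congrArg A (Subtype.ext hx.symm)).trans hx'
      · exact (congrArg A (Subtype.ext hy.symm)).trans hy'

variable {Ω : K →ₗ.[ℝ] K} {R : K →L[ℝ] K}

theorem IsResolvent.inner_nonneg (hR : IsResolvent Ω R)
    (hpos : ∀ x : Ω.domain, 0 ≤ inner ℝ (x : K) (Ω x)) (x : K) : 0 ≤ inner ℝ (R x) x := by
  have h := inner_graph_nonneg hpos (hR.mem_graph x)
  rw [inner_sub_right] at h
  linarith [real_inner_self_nonneg (x := R x)]

/-- Positivity of `Ω` at `R x` reads `‖R x‖² ≤ ⟨R x, x⟩`; then apply Cauchy–Schwarz. -/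
theorem IsResolvent.norm_le (hR : IsResolvent Ω R)
    (hpos : ∀ x : Ω.domain, 0 ≤ inner ℝ (x : K) (Ω x)) : ‖R‖ ≤ 1 := by
  refine R.opNorm_le_bound zero_le_one fun x => ?_
  have h := inner_graph_nonneg hpos (hR.mem_graph x)
  rw [inner_sub_right, real_inner_self_eq_norm_sq] at h
  have := real_inner_le_norm (R x) x
  by_contra! hlt
  nlinarith [norm_nonneg x, norm_nonneg (R x)]

/-- The eigenvalue `0` of `R` would correspond to `ω = ∞`: it would put `(0, x)` in the graph, which
is single-valued. -/
theorem IsResolvent.eq_zero (hR : IsResolvent Ω R) {x : K} (h : R x = 0) : x = 0 := by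
  have hm := hR.mem_graph x
  rw [h, sub_zero] at hm
  exact LinearPMap.graph_fst_eq_zero_snd _ hm rfl

/-- The eigenvalue `1` of `R` corresponds to `ω = 0`, which the trivial kernel excludes. -/
theorem IsResolvent.eq_zero_of_fixed (hR : IsResolvent Ω R)
    (hker : ∀ x : Ω.domain, Ω x = 0 → x = 0) {x : K} (h : R x = x) : x = 0 := by
  have hm := hR.mem_graph x
  rw [h, sub_self] at hm
  obtain ⟨y, rfl, hy⟩ := (LinearPMap.mem_graph_iff _).mp hm
  exact congrArg Subtype.val (hker y hy)

theorem IsResolvent.inverseOneAdd_eq {Ω : K →ₗ.[ℝ] K} {R : K →L[ℝ] K} (hR : IsResolvent Ω R) :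
    inverseOneAdd (complexify Ω) = complexifyCLM R := by
  have hmem : ∀ y, (complexifyCLM R y, y - complexifyCLM R y) ∈ (complexify Ω).graph := fun y => by
    rw [complexify_graph_iff]
    exact ⟨hR.mem_graph y.re, hR.mem_graph y.im⟩
  have h : ∃ R' : Complexification K →L[ℂ] Complexification K,
      IsInverseOneAdd (complexify Ω) R' := by
    refine ⟨complexifyCLM R, fun x => ?_, fun y => ?_⟩
    · have h := (complexify_graph_iff Ω _ _).mp ((complexify Ω).mem_graph x)
      exact Complexification.ext ((hR _ _).mp h.1) ((hR _ _).mp h.2)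
    · obtain ⟨x, hx, hx'⟩ := (LinearPMap.mem_graph_iff _).mp (hmem y)
      refine ⟨x, hx, ?_⟩
      rw [hx, hx']
      simp
  -- The chosen inverse is forced: every `y` has the form `x + Ω x`, on which its value is
  -- prescribed.
  rw [inverseOneAdd, dif_pos h]
  ext1 y
  obtain ⟨x, hx, hx'⟩ := (LinearPMap.mem_graph_iff _).mp (hmem y)
  have h₁ := h.choose_spec.1 x
  rwa [hx, hx', add_sub_cancel] at h₁

variable [CompleteSpace K]

theorem graph_eq_adjoint {Ω : K →ₗ.[ℝ] K} (hself : IsSelfAdjoint Ω) :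
    Ω.graph = Ω.graph.adjoint := by
  have h := LinearPMap.adjoint_graph_eq_graph_adjoint hself.dense_domain
  rwa [LinearPMap.isSelfAdjoint_def.mp hself] at h

theorem inner_graph_comm {Ω : K →ₗ.[ℝ] K} (hself : IsSelfAdjoint Ω) {a b c d : K}
    (hab : (a, b) ∈ Ω.graph) (hcd : (c, d) ∈ Ω.graph) : inner ℝ b c = inner ℝ a d := by
  rw [graph_eq_adjoint hself] at hcd
  exact sub_eq_zero.mp ((Submodule.mem_adjoint_iff _ _).mp hcd a b hab)

/-- By positivity `‖a‖² + ‖b‖² ≤ ‖a + b‖²` on the graph, so `(a, b) ↦ a + b` is bounded below on a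
complete space and has closed range. Self-adjointness makes the range dense. -/
theorem exists_isResolvent {Ω : K →ₗ.[ℝ] K} (hself : IsSelfAdjoint Ω)
    (hpos : ∀ x : Ω.domain, 0 ≤ inner ℝ (x : K) (Ω x)) : ∃ R, IsResolvent Ω R := by
  let L : Ω.graph →L[ℝ] K :=
    (ContinuousLinearMap.fst ℝ K K + ContinuousLinearMap.snd ℝ K K).comp Ω.graph.subtypeL
  have hL : ∀ p : Ω.graph, L p = p.1.1 + p.1.2 := fun p => rfl
  have hle : ∀ p : Ω.graph, ‖p.1.1‖ ^ 2 + ‖p.1.2‖ ^ 2 ≤ ‖L p‖ ^ 2 := fun p => by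
    have h := inner_graph_nonneg hpos p.2
    rw [hL, norm_add_sq_real]
    linarith
  have hanti : AntilipschitzWith 1 L := by
    refine AddMonoidHomClass.antilipschitz_of_bound L fun p => ?_
    rw [NNReal.coe_one, one_mul]
    change max ‖p.1.1‖ ‖p.1.2‖ ≤ _
    have h := hle p
    refine max_le (abs_le_of_sq_le_sq' ?_ (norm_nonneg _)).2
      (abs_le_of_sq_le_sq' ?_ (norm_nonneg _)).2 <;>
      nlinarith [sq_nonneg ‖p.1.1‖, sq_nonneg ‖p.1.2‖]
  have : CompleteSpace Ω.graph := (hself.isClosed : IsClosed _).completeSpace_coe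
  have hclosed : IsClosed (L.range : Set K) := hanti.isClosed_range L.uniformContinuous
  have hrange : L.range = ⊤ := by
    have : CompleteSpace L.range := hclosed.completeSpace_coe
    rw [← Submodule.orthogonal_eq_bot_iff, Submodule.eq_bot_iff]
    intro w hw
    -- Orthogonality of `w` to all `a + b` says that `(w, -w)` lies in the adjoint graph, hence in
    -- the graph; positivity then gives `-‖w‖² ≥ 0`.
    have hmem : (w, -w) ∈ Ω.graph := by
      rw [graph_eq_adjoint hself, Submodule.mem_adjoint_iff]
      intro a b hab
      have h := (Submodule.mem_orthogonal _ _).mp hw (a + b) ⟨⟨(a, b), hab⟩, rfl⟩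
      rw [inner_add_left] at h
      simp only [inner_neg_right]
      linarith
    have h := inner_graph_nonneg hpos hmem
    rw [inner_neg_right, real_inner_self_eq_norm_sq] at h
    have : ‖w‖ = 0 := by nlinarith [norm_nonneg w]
    exact norm_eq_zero.mp this
  let e := ContinuousLinearEquiv.ofBijective L (LinearMap.ker_eq_bot.mpr hanti.injective) hrange
  have he : ∀ p, e p = L p := fun p => rfl
  refine ⟨(ContinuousLinearMap.fst ℝ K K).comp (Ω.graph.subtypeL.comp e.symm.toContinuousLinearMap),
    fun a b => ⟨fun h => ?_, fun h => ?_⟩⟩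
  · have h₁ : e.symm (a + b) = ⟨(a, b), h⟩ := by
      rw [ContinuousLinearEquiv.symm_apply_eq]
      rfl
    change (e.symm (a + b)).1.1 = a
    rw [h₁]
  · change (e.symm (a + b)).1.1 = a at h
    have h₁ : (e.symm (a + b)).1.1 + (e.symm (a + b)).1.2 = a + b := by
      rw [← hL, ← he, ContinuousLinearEquiv.apply_symm_apply]
    have h₂ : (e.symm (a + b)).1 = (a, b) := by
      refine Prod.ext h ?_
      rw [h] at h₁
      exact add_left_cancel h₁
    exact h₂ ▸ (e.symm (a + b)).2

theorem IsResolvent.inner_comm (hR : IsResolvent Ω R) (hself : IsSelfAdjoint Ω) (x y : K) :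
    inner ℝ (R x) y = inner ℝ x (R y) := by
  have h := inner_graph_comm hself (hR.mem_graph x) (hR.mem_graph y)
  rw [inner_sub_left, inner_sub_right] at h
  linarith

theorem IsResolvent.isPositive (hR : IsResolvent Ω R) (hself : IsSelfAdjoint Ω)
    (hpos : ∀ x : Ω.domain, 0 ≤ inner ℝ (x : K) (Ω x)) : (complexifyCLM R).IsPositive := by
  constructor
  · intro z w
    change inner ℂ (complexifyCLM R z) w = inner ℂ z (complexifyCLM R w)
    simp [inner_def, hR.inner_comm hself]
  · intro z
    change 0 ≤ (inner ℂ (complexifyCLM R z) z).re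
    exact add_nonneg (hR.inner_nonneg hpos _) (hR.inner_nonneg hpos _)

theorem IsResolvent.spectrum_subset (hR : IsResolvent Ω R) (hself : IsSelfAdjoint Ω)
    (hpos : ∀ x : Ω.domain, 0 ≤ inner ℝ (x : K) (Ω x)) :
    spectrum ℝ (complexifyCLM R) ⊆ Set.Icc 0 1 := by
  intro r hr
  refine ⟨SpectrumRestricts.nnreal_iff.mp (hR.isPositive hself hpos).spectrumRestricts r hr, ?_⟩
  have h := spectrum.norm_le_norm_mul_of_mem hr
  -- Only `≤ 1`, since `K` may be trivial.
  have h₁ : ‖(1 : Complexification K →L[ℂ] Complexification K)‖ ≤ 1 :=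
    ContinuousLinearMap.norm_id_le
  have h₂ := (norm_complexifyCLM_le R).trans (hR.norm_le hpos)
  calc r ≤ ‖r‖ := Real.le_norm_self r
    _ ≤ _ := h
    _ ≤ 1 * 1 := mul_le_mul h₂ h₁ (norm_nonneg _) zero_le_one
    _ = 1 := one_mul 1

end Resolvent

/-! ### Cutoff functions and cutoff operators -/

theorem IsCutoff.eq_zero {g : ℝ → ℝ} (hg : IsCutoff g) {ω : ℝ} (hω : ω ≤ 0) : g ω = 0 := by
  by_contra h
  exact not_lt.mpr hω (hg.2.2 (subset_tsupport g h))

/-- Singularities of `f` at `0` are harmless because `g` vanishes near them. This closure property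
drives the whole calculus. -/
theorem IsCutoff.mul {g f : ℝ → ℝ} (hg : IsCutoff g) (hf : ContinuousOn f (Set.Ioi 0)) :
    IsCutoff (fun ω => g ω * f ω) := by
  have hsub : tsupport (fun ω => g ω * f ω) ⊆ tsupport g := tsupport_mul_subset_left
  refine ⟨?_, hg.2.1.mul_right, hsub.trans hg.2.2⟩
  refine continuous_of_tsupport fun x hx => ?_
  have hx' := hg.2.2 (hsub hx)
  exact hg.1.continuousAt.mul (hf.continuousAt (isOpen_Ioi.mem_nhds hx'))

/-- A cutoff function of the variable `ω` is a continuous function of `r = (1 + ω)⁻¹`. -/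
theorem IsCutoff.continuous_comp {g : ℝ → ℝ} (hg : IsCutoff g) :
    Continuous (fun r : ℝ => g (r⁻¹ - 1)) := by
  rw [continuous_iff_continuousAt]
  intro r
  rcases eq_or_ne r 0 with rfl | hr
  · obtain ⟨M, hM⟩ := hg.2.1.isCompact.bddAbove
    have hev : (fun r : ℝ => g (r⁻¹ - 1)) =ᶠ[nhds 0] fun _ => 0 := by
      -- For `0 < r < (|M| + 2)⁻¹` the argument `r⁻¹ - 1` exceeds the bound `M` of the support; for
      -- `r ≤ 0`, including `0⁻¹ = 0`, it is at most `-1`.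
      have hlt : ∀ᶠ r : ℝ in nhds 0, r < (|M| + 2)⁻¹ :=
        gt_mem_nhds (by positivity)
      filter_upwards [hlt] with r hr
      rcases le_or_gt r 0 with h0 | h0
      · exact hg.eq_zero (by linarith [inv_nonpos.mpr h0])
      · by_contra hne
        have h₁ := hM (subset_tsupport g hne)
        have h₂ := (lt_inv_comm₀ h0 (by positivity)).mp hr
        linarith [le_abs_self M]
    exact continuousAt_const.congr hev.symm
  · exact hg.1.continuousAt.comp ((continuousAt_inv₀ hr).sub continuousAt_const)

/-- There are cutoff functions with values in `[0, 1]` that are equal to `1` on a given compact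
interval. -/
theorem exists_isCutoff_eq_one {a b : ℝ} (ha : 0 < a) :
    ∃ g, IsCutoff g ∧ (∀ ω, g ω ∈ Set.Icc (0 : ℝ) 1) ∧ ∀ ω ∈ Set.Icc a b, g ω = 1 := by
  have hcl : closure (Set.Ioo (a / 2) (b + 1)) ⊆ Set.Icc (a / 2) (b + 1) :=
    closure_minimal Set.Ioo_subset_Icc_self isClosed_Icc
  have hcp : IsCompact (closure (Set.Ioo (a / 2) (b + 1))) :=
    isCompact_Icc.of_isClosed_subset isClosed_closure hcl
  obtain ⟨f, hf, hf₁, hf₂⟩ := exists_tsupport_one_of_isOpen_isClosed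
    (s := Set.Ioo (a / 2) (b + 1)) (t := Set.Icc a b) isOpen_Ioo hcp isClosed_Icc
    fun x hx => ⟨by linarith [hx.1], by linarith [hx.2]⟩
  refine ⟨f, ⟨f.continuous, ?_, fun x hx => ?_⟩, hf₂, hf₁⟩
  · exact hcp.of_isClosed_subset (isClosed_tsupport _) (hf.trans subset_closure)
  · have := (hf hx).1
    exact lt_trans (by positivity) this

section CutoffOp

variable {E : Type*} [NormedAddCommGroup E] [InnerProductSpace ℂ E] [CompleteSpace E]

/-- The operator `g(A)` for a real cutoff function `g`, in terms of `R = (1 + A)⁻¹`. -/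
noncomputable def cutoffCfc (R : E →L[ℂ] E) (g : ℝ → ℝ) : E →L[ℂ] E :=
  cfc (fun r : ℝ => g (r⁻¹ - 1)) R

theorem cutoffOp_ofReal (A : E →ₗ.[ℂ] E) (g : ℝ → ℝ)
    (hA : IsSelfAdjoint (inverseOneAdd A)) :
    cutoffOp A (fun ω => (g ω : ℂ)) = cutoffCfc (inverseOneAdd A) g :=
  (cfc_real_eq_complex (fun r : ℝ => g (r⁻¹ - 1)) hA).symm

variable {R : E →L[ℂ] E}

theorem cutoffCfc_mul {g h : ℝ → ℝ} (hg : IsCutoff g) (hh : IsCutoff h) :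
    cutoffCfc R (fun ω => g ω * h ω) = cutoffCfc R g * cutoffCfc R h :=
  cfc_mul _ _ R hg.continuous_comp.continuousOn hh.continuous_comp.continuousOn

theorem norm_cutoffCfc_le {g : ℝ → ℝ} {C : ℝ} (hC : 0 ≤ C) (hg : ∀ ω, |g ω| ≤ C) :
    ‖cutoffCfc R g‖ ≤ C :=
  norm_cfc_le hC fun _ _ => hg _

/-- The defining relation `ω r = 1 - r` between the spectral variables, in operator form. -/
theorem cutoffCfc_id_mul {g : ℝ → ℝ} (hg : IsCutoff g) (hR : IsSelfAdjoint R) :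
    cutoffCfc R (fun ω => g ω * ω) * R = cutoffCfc R g * (1 - R) := by
  have hg' : Continuous (fun r : ℝ => g (r⁻¹ - 1) * (r⁻¹ - 1)) :=
    (hg.mul continuousOn_id).continuous_comp
  have h₁ : (1 : E →L[ℂ] E) - R = cfc (fun r : ℝ => 1 - r) R := by
    rw [cfc_sub (fun _ => 1) (fun r => r) R, cfc_const_one ℝ R, cfc_id' ℝ R]
  have h₂ : cutoffCfc R (fun ω => g ω * ω) * R =
      cutoffCfc R (fun ω => g ω * ω) * cfc (fun r : ℝ => r) R := by rw [cfc_id' ℝ R]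
  rw [h₁, h₂, cutoffCfc, cutoffCfc, ← cfc_mul _ _ R hg'.continuousOn (by fun_prop),
    ← cfc_mul _ _ R hg.continuous_comp.continuousOn (by fun_prop)]
  congr 1
  ext r
  -- With `0⁻¹ = 0` the function is evaluated at `ω = -1`, where the cutoff vanishes, so both sides
  -- are `0`.
  rcases eq_or_ne r 0 with rfl | hr
  · simp [hg.eq_zero (show (-1 : ℝ) ≤ 0 by norm_num)]
  · field_simp

theorem cutoffCfc_commute (g : ℝ → ℝ) : Commute (cutoffCfc R g) R :=
  (Commute.refl R).cfc_real _

/-- Cutoff operators approximate the identity strongly, provided that neither `0` nor `1` is an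
eigenvalue of `R`. -/
theorem exists_cutoffCfc_sub_lt (hR : IsSelfAdjoint R) (hspec : spectrum ℝ R ⊆ Set.Icc 0 1)
    (h0 : ∀ x, R x = 0 → x = 0) (h1 : ∀ x, R x = x → x = 0) (x : E) {ε : ℝ} (hε : 0 < ε) :
    ∃ g, IsCutoff g ∧ (∀ ω, g ω ∈ Set.Icc (0 : ℝ) 1) ∧ ‖cutoffCfc R g x - x‖ < ε := by
  -- The factor `r (1 - r)` is small near both ends of the spectrum, exactly where a cutoff differs
  -- from `1`. So cutoffs converge to the identity uniformly after composition with `S`, and `S` has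
  -- dense range since it is self-adjoint and injective.
  set S : E →L[ℂ] E := R * (1 - R) with hS
  have hScfc : S = cfc (fun r : ℝ => r * (1 - r)) R := by
    rw [cfc_mul (fun r : ℝ => r) (fun r => 1 - r) R, cfc_sub (fun _ => 1) (fun r => r) R,
      cfc_const_one ℝ R, cfc_id' ℝ R]
  have hSself : IsSelfAdjoint S := by
    rw [hScfc]
    exact cfc_predicate _ R
  have hdense : DenseRange S := by
    have hker : S.ker = ⊥ := by
      rw [LinearMap.ker_eq_bot']
      intro y hy
      have hy' : R (y - R y) = 0 := hy
      exact h1 y (sub_eq_zero.mp (h0 _ hy')).symm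
    have h := ContinuousLinearMap.IsStarNormal.orthogonal_range hSself.isStarNormal
    rw [hker, ← Submodule.topologicalClosure_eq_top_iff,
      ← Submodule.dense_iff_topologicalClosure_eq_top] at h
    exact h
  obtain ⟨v, hv⟩ := hdense.exists_dist_lt x (show 0 < ε / 3 by positivity)
  set δ : ℝ := ε / (3 * (‖v‖ + 1)) with hδ
  have hδ0 : 0 < δ := by positivity
  have hδv : δ * ‖v‖ < ε / 3 := by
    rw [hδ, div_mul_eq_mul_div, div_lt_div_iff₀ (by positivity) (by norm_num)]
    nlinarith [norm_nonneg v]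
  obtain ⟨g, hg, hg01, hg1⟩ := exists_isCutoff_eq_one (b := δ⁻¹) hδ0
  refine ⟨g, hg, hg01, ?_⟩
  have hnorm : ‖cutoffCfc R g‖ ≤ 1 :=
    norm_cutoffCfc_le zero_le_one fun ω => abs_le.mpr ⟨by linarith [(hg01 ω).1], (hg01 ω).2⟩
  have hSdiff : ‖cutoffCfc R g * S - S‖ ≤ δ := by
    have hc := hg.continuous_comp
    have hc' : ContinuousOn (fun r : ℝ => g (r⁻¹ - 1) * (r * (1 - r))) (spectrum ℝ R) :=
      (hc.mul (by fun_prop)).continuousOn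
    rw [hScfc, cutoffCfc, ← cfc_mul _ _ R hc.continuousOn (by fun_prop),
      ← cfc_sub _ _ R hc' (by fun_prop)]
    refine norm_cfc_le hδ0.le fun r hr => ?_
    obtain ⟨hr0, hr1⟩ := hspec hr
    set c := g (r⁻¹ - 1) with hcdef
    have hc01 := hg01 (r⁻¹ - 1)
    rw [Real.norm_eq_abs, show c * (r * (1 - r)) - r * (1 - r) = -((1 - c) * (r * (1 - r))) by ring,
      abs_neg, abs_of_nonneg (mul_nonneg (by linarith [hc01.2])
        (mul_nonneg hr0 (by linarith)))]
    have hprod : 0 ≤ r * (1 - r) := mul_nonneg hr0 (by linarith)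
    have hle : (1 - c) * (r * (1 - r)) ≤ r * (1 - r) := by nlinarith [hc01.1]
    -- If `r < δ` or `1 - r < δ`, then `r (1 - r) ≤ δ`. Otherwise `δ ≤ r⁻¹ - 1 ≤ δ⁻¹`, where `g =
    -- 1`.
    rcases lt_or_ge r δ with h | h
    · nlinarith
    rcases lt_or_ge (1 - r) δ with h' | h'
    · nlinarith
    have hrpos : 0 < r := hδ0.trans_le h
    have hone : c = 1 := by
      refine hg1 _ ⟨?_, ?_⟩
      · have : 1 ≤ r⁻¹ := (one_le_inv₀ hrpos).mpr hr1
        have h₂ : r⁻¹ - 1 = (1 - r) * r⁻¹ := by field_simp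
        rw [h₂]
        nlinarith
      · have := inv_anti₀ hδ0 h
        linarith
    rw [hone]
    linarith [hδ0]
  have hxv : ‖x - S v‖ < ε / 3 := by rwa [← dist_eq_norm]
  have e₁ : cutoffCfc R g x - x =
      cutoffCfc R g (x - S v) + (cutoffCfc R g * S - S) v - (x - S v) := by
    simp only [map_sub, sub_apply, mul_apply_eq_comp]
    abel
  rw [e₁]
  have b₁ : ‖cutoffCfc R g (x - S v)‖ ≤ ‖x - S v‖ := by
    simpa using (cutoffCfc R g).le_of_opNorm_le hnorm (x - S v)
  have b₂ : ‖(cutoffCfc R g * S - S) v‖ ≤ δ * ‖v‖ :=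
    (cutoffCfc R g * S - S).le_of_opNorm_le hSdiff v
  have := norm_sub_le (cutoffCfc R g (x - S v) + (cutoffCfc R g * S - S) v) (x - S v)
  have := norm_add_le (cutoffCfc R g (x - S v)) ((cutoffCfc R g * S - S) v)
  linarith

end CutoffOp

/-! ### Cutoff operators on the real Hilbert space -/

section RealCutoff

variable {K : Type*} [NormedAddCommGroup K]

theorem Complexification.norm_re_le (z : Complexification K) : ‖z.re‖ ≤ ‖z‖ := by
  rw [← sq_le_sq₀ (norm_nonneg _) (norm_nonneg _), norm_sq_eq]
  linarith [sq_nonneg ‖z.im‖]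

theorem Complexification.norm_im_le (z : Complexification K) : ‖z.im‖ ≤ ‖z‖ := by
  rw [← sq_le_sq₀ (norm_nonneg _) (norm_nonneg _), norm_sq_eq]
  linarith [sq_nonneg ‖z.re‖]

@[simp] theorem Complexification.re_sub (z w : Complexification K) :
    (z - w).re = z.re - w.re := rfl

@[simp] theorem Complexification.im_sub (z w : Complexification K) :
    (z - w).im = z.im - w.im := rfl

theorem Complexification.continuous_im :
    Continuous (fun z : Complexification K => z.im) :=
  (LipschitzWith.of_dist_le_mul (K := 1) fun z w => by
    rw [dist_eq_norm, dist_eq_norm, NNReal.coe_one, one_mul, ← im_sub]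
    exact norm_im_le _).continuous

variable [InnerProductSpace ℝ K]

@[simp] theorem Complexification.re_ofReal (x : K) : (ofReal x).re = x := rfl

@[simp] theorem Complexification.im_ofReal (x : K) : (ofReal x).im = 0 := rfl

theorem Complexification.norm_ofReal (x : K) : ‖ofReal x‖ = ‖x‖ := by
  rw [← sq_eq_sq₀ (norm_nonneg _) (norm_nonneg _), norm_sq_eq]
  simp

theorem Complexification.eq_ofReal_add (z : Complexification K) :
    z = ofReal z.re + Complex.I • ofReal z.im := by
  ext <;> simp

theorem Complexification.real_smul_eq (r : ℝ) (z : Complexification K) : r • z = (r : ℂ) • z := rfl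

/-- The real part of a bounded operator on the complexification, restricted to the real space. -/
noncomputable def realPart (T : Complexification K →L[ℂ] Complexification K) : K →L[ℝ] K :=
  LinearMap.mkContinuous
    { toFun := fun x => (T (ofReal x)).re
      map_add' := fun x y => by simp
      map_smul' := fun r x => by
        rw [map_smul, real_smul_eq, map_smul, re_smul]
        simp } ‖T‖ fun x => by
    exact (norm_re_le _).trans ((T.le_opNorm _).trans_eq (by rw [norm_ofReal]))

theorem realPart_apply (T : Complexification K →L[ℂ] Complexification K) (x : K) :
    realPart T x = (T (ofReal x)).re := rfl

theorem norm_realPart_le (T : Complexification K →L[ℂ] Complexification K) :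
    ‖realPart T‖ ≤ ‖T‖ :=
  (realPart T).opNorm_le_bound T.opNorm_nonneg fun x =>
    (norm_re_le _).trans ((T.le_opNorm _).trans_eq (by rw [norm_ofReal]))

/-- `T` maps the real space into itself. -/
def IsReal (T : Complexification K →L[ℂ] Complexification K) : Prop :=
  ∀ x : K, (T (ofReal x)).im = 0

theorem IsReal.ofReal_realPart {T : Complexification K →L[ℂ] Complexification K} (hT : IsReal T)
    (x : K) : ofReal (realPart T x) = T (ofReal x) := by
  apply Complexification.ext
  · rfl
  · rw [hT x, im_ofReal]

theorem IsReal.apply {T : Complexification K →L[ℂ] Complexification K} (hT : IsReal T)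
    (z : Complexification K) : T z = mk (realPart T z.re) (realPart T z.im) := by
  conv_lhs => rw [eq_ofReal_add z, map_add, map_smul, ← hT.ofReal_realPart, ← hT.ofReal_realPart]
  ext <;> simp

theorem isReal_complexifyCLM (R : K →L[ℝ] K) : IsReal (complexifyCLM R) := fun x => by simp

variable [CompleteSpace K]

/-- Stone–Weierstrass: the functions `f` for which `f(T)` preserves the real space form a closed
real algebra containing the constants and the identity. -/
theorem IsReal.cfc {T : Complexification K →L[ℂ] Complexification K} (hT : IsReal T)
    (hself : IsSelfAdjoint T) (f : ℝ → ℝ) : IsReal (cfc f T) := by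
  by_cases hf : ContinuousOn f (spectrum ℝ T)
  swap
  -- Here `cfc` takes its default value `0`, which is real.
  · rw [cfc_apply_of_not_continuousOn T hf]
    exact fun x => rfl
  rw [cfc_apply f T hself hf]
  generalize (⟨_, hf.domRestrict⟩ : C(spectrum ℝ T, ℝ)) = φ
  induction φ using ContinuousMap.induction_on_of_compact with
  | const r =>
    intro x
    have h : cfcHom hself (ContinuousMap.const _ r) =
        algebraMap ℝ (Complexification K →L[ℂ] Complexification K) r :=
      AlgHomClass.commutes (cfcHom hself) r
    rw [h, Algebra.algebraMap_eq_smul_one]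
    change ((r : ℂ) • ofReal x).im = 0
    rw [im_smul]
    simp
  | id => rwa [cfcHom_id hself]
  | star_id => rwa [map_star, cfcHom_id hself, hself.star_eq]
  | add f g hf hg =>
    intro x
    rw [map_add, add_apply, im_add, hf x, hg x, add_zero]
  | mul f g hf hg =>
    intro x
    rw [map_mul, mul_apply_eq_comp, ← hg.ofReal_realPart]
    exact hf _
  | frequently f hf =>
    intro x
    have hcl : IsClosed {S : Complexification K →L[ℂ] Complexification K |
        (S (ofReal x)).im = 0} :=
      isClosed_eq (continuous_im.comp (by fun_prop)) continuous_const
    rw [← Set.mem_ofPred (p := fun S : Complexification K →L[ℂ] Complexification K =>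
      (S (ofReal x)).im = 0), ← hcl.closure_eq]
    exact mem_closure_of_frequently_of_tendsto (hf.mono fun _ h => h x)
      ((cfcHom_continuous hself).tendsto _)

/-- `R` is the inverse of `1 + Ω`, where `Ω` is positive and self-adjoint with trivial kernel. -/
structure IsPositiveResolvent (Ω : K →ₗ.[ℝ] K) (R : K →L[ℝ] K) : Prop where
  selfAdjoint : IsSelfAdjoint Ω
  nonneg : ∀ x : Ω.domain, 0 ≤ inner ℝ (x : K) (Ω x)
  ker : ∀ x : Ω.domain, Ω x = 0 → x = 0
  isResolvent : IsResolvent Ω R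

variable {Ω : K →ₗ.[ℝ] K} {R : K →L[ℝ] K}

theorem IsPositiveResolvent.isSelfAdjoint (h : IsPositiveResolvent Ω R) :
    IsSelfAdjoint (complexifyCLM R) :=
  (h.isResolvent.isPositive h.selfAdjoint h.nonneg).isSelfAdjoint

/-- The operator `g(Ω)` on the real Hilbert space for a cutoff function `g`. -/
noncomputable def realCutoff (R : K →L[ℝ] K) (g : ℝ → ℝ) : K →L[ℝ] K :=
  realPart (cutoffCfc (complexifyCLM R) g)

theorem IsPositiveResolvent.isReal (h : IsPositiveResolvent Ω R) (g : ℝ → ℝ) :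
    IsReal (cutoffCfc (complexifyCLM R) g) :=
  (isReal_complexifyCLM R).cfc h.isSelfAdjoint _

theorem IsPositiveResolvent.ofReal_realCutoff (h : IsPositiveResolvent Ω R) (g : ℝ → ℝ) (x : K) :
    ofReal (realCutoff R g x) = cutoffCfc (complexifyCLM R) g (ofReal x) :=
  (h.isReal g).ofReal_realPart x

theorem IsPositiveResolvent.cutoffOp_ofReal (h : IsPositiveResolvent Ω R) (g : ℝ → ℝ) :
    cutoffOp (complexify Ω) (fun ω => (g ω : ℂ)) = cutoffCfc (complexifyCLM R) g := by
  have hA := h.isResolvent.inverseOneAdd_eq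
  rw [OscillatorField.cutoffOp_ofReal, hA]
  rw [hA]
  exact h.isSelfAdjoint

theorem IsPositiveResolvent.realCutoff_mul (h : IsPositiveResolvent Ω R) {g f : ℝ → ℝ}
    (hg : IsCutoff g) (hf : IsCutoff f) (x : K) :
    realCutoff R (fun ω => g ω * f ω) x = realCutoff R g (realCutoff R f x) := by
  rw [realCutoff, realPart_apply, cutoffCfc_mul hg hf, mul_apply_eq_comp, ← h.ofReal_realCutoff]
  rfl

theorem norm_realCutoff_apply_le (R : K →L[ℝ] K) {g : ℝ → ℝ} {C : ℝ} (hC : 0 ≤ C)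
    (hg : ∀ ω, |g ω| ≤ C) (x : K) : ‖realCutoff R g x‖ ≤ C * ‖x‖ :=
  have h₁ : ‖cutoffCfc (complexifyCLM R) g‖ ≤ C := norm_cutoffCfc_le hC hg
  have h₂ : ‖realCutoff R g‖ ≤ C := le_trans (norm_realPart_le _) h₁
  (realCutoff R g).le_of_opNorm_le h₂ x

theorem IsPositiveResolvent.exists_realCutoff_sub_lt (h : IsPositiveResolvent Ω R) (x : K)
    {ε : ℝ} (hε : 0 < ε) :
    ∃ g, IsCutoff g ∧ (∀ ω, g ω ∈ Set.Icc (0 : ℝ) 1) ∧ ‖realCutoff R g x - x‖ < ε := by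
  have hre : ∀ z, (complexifyCLM R z).re = R z.re := fun z => rfl
  have him : ∀ z, (complexifyCLM R z).im = R z.im := fun z => rfl
  have h0 : ∀ z, complexifyCLM R z = 0 → z = 0 := fun z hz => by
    have h₁ := hre z
    have h₂ := him z
    rw [hz] at h₁ h₂
    exact Complexification.ext (h.isResolvent.eq_zero h₁.symm) (h.isResolvent.eq_zero h₂.symm)
  have h1 : ∀ z, complexifyCLM R z = z → z = 0 := fun z hz => by
    have h₁ := hre z
    have h₂ := him z
    rw [hz] at h₁ h₂
    exact Complexification.ext (h.isResolvent.eq_zero_of_fixed h.ker h₁.symm)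
      (h.isResolvent.eq_zero_of_fixed h.ker h₂.symm)
  obtain ⟨g, hg, hg₁, hg₂⟩ := exists_cutoffCfc_sub_lt h.isSelfAdjoint
    (h.isResolvent.spectrum_subset h.selfAdjoint h.nonneg) h0 h1 (ofReal x) hε
  refine ⟨g, hg, hg₁, ?_⟩
  rwa [← h.ofReal_realCutoff, ← map_sub, norm_ofReal] at hg₂

/-- Cutoffs separate points: if `x ≠ 0`, some `g(Ω) x` is closer to `x` than `‖x‖`, hence nonzero.
Every identity of operators below is tested this way. -/
theorem IsPositiveResolvent.eq_zero_of_realCutoff (h : IsPositiveResolvent Ω R) {x : K}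
    (hx : ∀ g, IsCutoff g → realCutoff R g x = 0) : x = 0 := by
  by_contra hne
  obtain ⟨g, hg, -, hlt⟩ := h.exists_realCutoff_sub_lt x (norm_pos_iff.mpr hne)
  rw [hx g hg, zero_sub, norm_neg] at hlt
  exact lt_irrefl _ hlt

theorem IsPositiveResolvent.realCutoff_id (h : IsPositiveResolvent Ω R) {g : ℝ → ℝ}
    (hg : IsCutoff g) (x : K) :
    realCutoff R (fun ω => g ω * ω) (R x) = realCutoff R g (x - R x) := by
  have h₁ := congrArg re (DFunLike.congr_fun (cutoffCfc_id_mul hg h.isSelfAdjoint) (ofReal x))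
  have h₂ : complexifyCLM R (ofReal x) = ofReal (R x) := by ext <;> simp
  rw [mul_apply_eq_comp, mul_apply_eq_comp, sub_apply, one_apply_eq_self, h₂, ← map_sub] at h₁
  exact h₁

theorem IsPositiveResolvent.realCutoff_comm (h : IsPositiveResolvent Ω R) (g : ℝ → ℝ) (x : K) :
    realCutoff R g (R x) = R (realCutoff R g x) := by
  have h₁ := congrArg re (DFunLike.congr_fun
    (cutoffCfc_commute (R := complexifyCLM R) g).eq (ofReal x))
  have h₂ : complexifyCLM R (ofReal x) = ofReal (R x) := by ext <;> simp
  rw [mul_apply_eq_comp, mul_apply_eq_comp, h₂, ← h.ofReal_realCutoff, complexifyCLM_re] at h₁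
  exact h₁

end RealCutoff

/-! ### Graphs of functions of `Ω` -/

section Graph

variable {K : Type*} [NormedAddCommGroup K] [InnerProductSpace ℝ K] [CompleteSpace K]
variable {Ω : K →ₗ.[ℝ] K} {R : K →L[ℝ] K}

theorem IsPositiveResolvent.cutoffOp_mul_ofReal (h : IsPositiveResolvent Ω R) (g f : ℝ → ℝ) :
    cutoffOp (complexify Ω) (fun ω => (g ω : ℂ) * (f ω : ℂ)) =
      cutoffCfc (complexifyCLM R) (fun ω => g ω * f ω) := by
  rw [← h.cutoffOp_ofReal]
  simp only [Complex.ofReal_mul]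

theorem IsPositiveResolvent.mem_graph_iff (h : IsPositiveResolvent Ω R) (f : ℝ → ℝ) (a b : K) :
    (a, b) ∈ (realFunctionOf Ω f).graph ↔
      ∀ g, IsCutoff g → realCutoff R g b = realCutoff R (fun ω => g ω * f ω) a := by
  have key : ∀ a b : K, (a, b) ∈
      ((functionGraph (complexify Ω) (fun ω => (f ω : ℂ))).restrictScalars ℝ).comap
        (Complexification.ofReal.prodMap Complexification.ofReal) ↔
      ∀ g, IsCutoff g → realCutoff R g b = realCutoff R (fun ω => g ω * f ω) a := by
    intro a b
    change (∀ g : ℝ → ℝ, IsCutoff g → cutoffOp (complexify Ω) (fun ω => (g ω : ℂ)) (ofReal b) =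
      cutoffOp (complexify Ω) (fun ω => (g ω : ℂ) * (f ω : ℂ)) (ofReal a)) ↔ _
    refine forall₂_congr fun g _ => ?_
    rw [h.cutoffOp_ofReal, h.cutoffOp_mul_ofReal, ← h.ofReal_realCutoff, ← h.ofReal_realCutoff]
    refine ⟨fun h' => ?_, fun h' => congrArg ofReal h'⟩
    have h₁ := congrArg re h'
    rwa [re_ofReal, re_ofReal] at h₁
  rw [realFunctionOf, Submodule.toLinearPMap_graph_eq, key]
  -- The set of pairs is single-valued, so passing to an operator loses none of it.
  rintro ⟨a, b⟩ hab hfst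
  obtain rfl : a = 0 := hfst
  refine h.eq_zero_of_realCutoff fun g hg => ?_
  rw [(key _ _).mp hab g hg, map_zero]

/-- If `u = f(Ω) a`, then `v = m(Ω) u` if and only if `v = (m f)(Ω) a`. -/
theorem IsPositiveResolvent.mem_graph_mul_iff (h : IsPositiveResolvent Ω R) {f m k : ℝ → ℝ}
    {a u v : K} (hm : ContinuousOn m (Set.Ioi 0)) (hk : ∀ ω, 0 < ω → k ω = m ω * f ω)
    (hu : (a, u) ∈ (realFunctionOf Ω f).graph) :
    (a, v) ∈ (realFunctionOf Ω k).graph ↔ (u, v) ∈ (realFunctionOf Ω m).graph := by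
  rw [h.mem_graph_iff] at hu ⊢
  rw [h.mem_graph_iff]
  refine forall₂_congr fun g hg => ?_
  -- As `g m` is itself a cutoff, it may serve as a test function for `u = f(Ω) a`.
  rw [hu _ (hg.mul hm)]
  have : (fun ω => g ω * k ω) = fun ω => g ω * m ω * f ω := by
    ext ω
    rcases le_or_gt ω 0 with hω | hω
    · simp [hg.eq_zero hω]
    · rw [hk ω hω, mul_assoc]
  rw [this]

theorem IsPositiveResolvent.mem_graph_one_iff (h : IsPositiveResolvent Ω R) {a b : K} :
    (a, b) ∈ (realFunctionOf Ω (fun _ => 1)).graph ↔ b = a := by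
  rw [h.mem_graph_iff]
  simp only [mul_one]
  refine ⟨fun hab => ?_, fun hab g _ => by rw [hab]⟩
  refine sub_eq_zero.mp (h.eq_zero_of_realCutoff fun g hg => ?_)
  rw [map_sub, hab g hg, sub_self]

theorem IsPositiveResolvent.mem_graph_inv (h : IsPositiveResolvent Ω R) {f k : ℝ → ℝ} {a b : K}
    (hk : ContinuousOn k (Set.Ioi 0)) (hkf : ∀ ω, 0 < ω → k ω * f ω = 1)
    (hab : (a, b) ∈ (realFunctionOf Ω f).graph) : (b, a) ∈ (realFunctionOf Ω k).graph :=
  (h.mem_graph_mul_iff (k := fun _ => 1) hk (fun ω hω => (hkf ω hω).symm) hab).mp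
    (h.mem_graph_one_iff.mpr rfl)

/-- Vectors `g(Ω) a` lie in the domain of every `f(Ω)` with `f` continuous on `(0, ∞)`; they supply
the dense sets used later. -/
theorem IsPositiveResolvent.cutoff_mem_graph (h : IsPositiveResolvent Ω R) {f g : ℝ → ℝ}
    (hf : ContinuousOn f (Set.Ioi 0)) (hg : IsCutoff g) (a : K) :
    (realCutoff R g a, realCutoff R (fun ω => g ω * f ω) a) ∈ (realFunctionOf Ω f).graph := by
  rw [h.mem_graph_iff]
  intro k hk
  rw [← h.realCutoff_mul hk (hg.mul hf), ← h.realCutoff_mul (hk.mul hf) hg]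
  congr 2
  ext ω
  ring

/-- `f(Ω)` commutes with the cutoff operators. -/
theorem IsPositiveResolvent.cutoff_apply_mem_graph (h : IsPositiveResolvent Ω R) {f g : ℝ → ℝ}
    (hf : ContinuousOn f (Set.Ioi 0)) (hg : IsCutoff g) {a b : K}
    (hab : (a, b) ∈ (realFunctionOf Ω f).graph) :
    (realCutoff R g a, realCutoff R g b) ∈ (realFunctionOf Ω f).graph := by
  rw [(h.mem_graph_iff f a b).mp hab g hg]
  exact h.cutoff_mem_graph hf hg a

/-- For `0 ≤ g ≤ 1` one has `|g m| ≤ C`, so `‖g(Ω) b‖ ≤ C ‖a‖`; let `g(Ω) b` tend to `b`. -/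
theorem IsPositiveResolvent.norm_le_of_mem_graph (h : IsPositiveResolvent Ω R) {m : ℝ → ℝ} {C : ℝ}
    (hC : 0 ≤ C) (hm : ∀ ω, 0 < ω → |m ω| ≤ C) {a b : K}
    (hab : (a, b) ∈ (realFunctionOf Ω m).graph) : ‖b‖ ≤ C * ‖a‖ := by
  refine le_of_forall_pos_lt_add fun ε hε => ?_
  obtain ⟨g, hg, hg01, hlt⟩ := h.exists_realCutoff_sub_lt b hε
  have h₁ : ‖realCutoff R g b‖ ≤ C * ‖a‖ := by
    rw [(h.mem_graph_iff m a b).mp hab g hg]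
    refine norm_realCutoff_apply_le R hC (fun ω => ?_) a
    rcases le_or_gt ω 0 with hω | hω
    · simpa [hg.eq_zero hω]
    · rw [abs_mul, abs_of_nonneg (hg01 ω).1]
      nlinarith [(hg01 ω).1, (hg01 ω).2, hm ω hω, abs_nonneg (m ω)]
  have h₂ := norm_sub_norm_le b (realCutoff R g b)
  rw [norm_sub_rev] at h₂
  linarith

/-- Consistency of the calculus with `Ω` itself, needed because `J` involves `Ω` and not a function
of it. Both directions use `ω r = 1 - r`. -/
theorem IsPositiveResolvent.mem_graph_id_iff (h : IsPositiveResolvent Ω R) {a b : K} :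
    (a, b) ∈ Ω.graph ↔ (a, b) ∈ (realFunctionOf Ω (fun ω => ω)).graph := by
  rw [h.mem_graph_iff, h.isResolvent a b]
  constructor
  · intro hab g hg
    have h₁ := h.realCutoff_id hg (a + b)
    rwa [hab, add_sub_cancel_left, eq_comm] at h₁
  · intro hab
    refine sub_eq_zero.mp (h.eq_zero_of_realCutoff fun g hg => ?_)
    have h₁ := h.realCutoff_id hg a
    -- Writing `g` for `g(Ω)`: `g R b = R g b = R (gω) a = (gω) R a = g (a - R a)`.
    have h₂ : realCutoff R g (R b) = realCutoff R g (a - R a) := by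
      rw [h.realCutoff_comm, hab g hg, ← h.realCutoff_comm, h₁]
    rw [map_sub, map_add, map_add, h₂, map_sub]
    abel

theorem IsPositiveResolvent.mem_graph_inverse_iff (h : IsPositiveResolvent Ω R) {a b : K} :
    (a, b) ∈ Ω.inverse.graph ↔ (a, b) ∈ (realFunctionOf Ω (fun ω => ω⁻¹)).graph := by
  have hker : LinearMap.ker Ω.toFun = ⊥ :=
    LinearMap.ker_eq_bot'.mpr fun x hx => h.ker x hx
  have hinv : ContinuousOn (fun ω : ℝ => ω⁻¹) (Set.Ioi 0) :=
    continuousOn_inv₀.mono fun ω hω => ne_of_gt hω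
  have h₁ : (a, b) ∈ Ω.inverse.graph ↔ (b, a) ∈ Ω.graph := by
    rw [LinearPMap.inverse_graph hker]
    constructor
    · rintro ⟨⟨x, y⟩, hxy, he⟩
      cases he
      exact hxy
    · exact fun hab => ⟨(b, a), hab, rfl⟩
  rw [h₁, h.mem_graph_id_iff]
  exact ⟨h.mem_graph_inv hinv fun ω hω => inv_mul_cancel₀ hω.ne',
    h.mem_graph_inv continuousOn_id fun ω hω => mul_inv_cancel₀ hω.ne'⟩

/-! ### The scale of spaces -/

theorem continuousOn_rpow (lam : ℝ) : ContinuousOn (fun ω : ℝ => ω ^ lam) (Set.Ioi 0) :=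
  fun ω hω => (Real.continuousAt_rpow_const ω lam (Or.inl (ne_of_gt hω))).continuousWithinAt

theorem norm_toScale (Ω : K →ₗ.[ℝ] K) (lam : ℝ) (x : (power Ω lam).domain) :
    ‖toScale Ω lam x‖ = ‖power Ω lam x‖ :=
  UniformSpace.Completion.norm_coe (E := PreScale Ω lam) x

theorem denseRange_toScale (Ω : K →ₗ.[ℝ] K) (lam : ℝ) : DenseRange (toScale Ω lam) :=
  UniformSpace.Completion.denseRange_coe (α := PreScale Ω lam)

theorem scalePower_toScale (Ω : K →ₗ.[ℝ] K) (lam : ℝ) (x : (power Ω lam).domain) :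
    scalePower Ω lam (toScale Ω lam x) = power Ω lam x :=
  LinearMap.extendOfNorm_eq (denseRange_toScale Ω lam)
    ⟨1, fun x => by rw [one_mul, norm_toScale]; rfl⟩ x

theorem norm_scalePower (Ω : K →ₗ.[ℝ] K) (lam : ℝ) (x : Scale Ω lam) :
    ‖scalePower Ω lam x‖ = ‖x‖ := by
  refine (denseRange_toScale Ω lam).induction_on (p := fun x => ‖scalePower Ω lam x‖ = ‖x‖) x
    (isClosed_eq (by fun_prop) (by fun_prop)) fun y => ?_
  rw [scalePower_toScale, norm_toScale]

/-- An isometry of a complete space has closed range, and this range contains the dense set of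
vectors `g(Ω) v`, each being `Ω^lam` applied to `(g ω^(-lam))(Ω) v`. -/
theorem IsPositiveResolvent.scalePower_surjective (h : IsPositiveResolvent Ω R) (lam : ℝ) :
    Function.Surjective (scalePower Ω lam) := by
  have hiso : Isometry (scalePower Ω lam) :=
    AddMonoidHomClass.isometry_of_norm _ (norm_scalePower Ω lam)
  have hdense : DenseRange (scalePower Ω lam) := by
    intro v
    rw [Metric.mem_closure_iff]
    intro ε hε
    obtain ⟨g, hg, -, hlt⟩ := h.exists_realCutoff_sub_lt v hε
    have hmem : (realCutoff R (fun ω => g ω * ω ^ (-lam)) v, realCutoff R g v) ∈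
        (power Ω lam).graph :=
      h.mem_graph_inv (continuousOn_rpow lam)
        (fun ω hω => by rw [← Real.rpow_add hω, add_neg_cancel, Real.rpow_zero])
        (h.cutoff_mem_graph (continuousOn_rpow (-lam)) hg v)
    obtain ⟨x, -, hx⟩ := (LinearPMap.mem_graph_iff _).mp hmem
    refine ⟨_, ⟨toScale Ω lam x, rfl⟩, ?_⟩
    rw [scalePower_toScale, hx, dist_comm, dist_eq_norm]
    exact hlt
  rw [← Set.range_eq_univ, ← hiso.isClosedEmbedding.isClosed_range.closure_eq]
  exact hdense.closure_range

/-- The extension by continuity of `f(Ω)` to an operator `K_lam → K_mu` corresponds to the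
multiplier `m`, where `ω ^ mu * f ω = m ω * ω ^ lam`. -/
theorem IsPositiveResolvent.scaleExtend_mem_graph (h : IsPositiveResolvent Ω R) {T : K →ₗ.[ℝ] K}
    {f m : ℝ → ℝ} {lam mu C : ℝ}
    (hT : ∀ a b, (a, b) ∈ T.graph ↔ (a, b) ∈ (realFunctionOf Ω f).graph)
    (hf : ContinuousOn f (Set.Ioi 0)) (hm : ContinuousOn m (Set.Ioi 0))
    (hC : 0 ≤ C) (hmC : ∀ ω, 0 < ω → |m ω| ≤ C)
    (hmf : ∀ ω, 0 < ω → ω ^ mu * f ω = m ω * ω ^ lam) (x : Scale Ω lam) :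
    (scalePower Ω lam x, scalePower Ω mu (scaleExtend Ω T lam mu x)) ∈
      (realFunctionOf Ω m).graph := by
  set e := (toScale Ω lam).comp
      ((LinearMap.fst ℝ K K).restrict (p := scaleCore Ω T lam mu) (q := (power Ω lam).domain)
        fun _ hp => hp.2.1) with he
  set F := (toScale Ω mu).comp
      ((LinearMap.snd ℝ K K).restrict (p := scaleCore Ω T lam mu) (q := (power Ω mu).domain)
        fun _ hp => hp.2.2) with hF
  have hex : ∀ p : scaleCore Ω T lam mu, e p = toScale Ω lam ⟨p.1.1, p.2.2.1⟩ := fun p => rfl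
  have hFx : ∀ p : scaleCore Ω T lam mu, F p = toScale Ω mu ⟨p.1.2, p.2.2.2⟩ := fun p => rfl
  have hgraph : ∀ p : scaleCore Ω T lam mu, (scalePower Ω lam (e p), scalePower Ω mu (F p)) ∈
      (realFunctionOf Ω m).graph := fun p => by
    rw [hex, hFx, scalePower_toScale, scalePower_toScale]
    have h₁ := (hT p.1.1 p.1.2).mp p.2.1
    have h₂ : (p.1.2, power Ω mu ⟨p.1.2, p.2.2.2⟩) ∈ (realFunctionOf Ω (fun ω => ω ^ mu)).graph :=
      (power Ω mu).mem_graph ⟨p.1.2, p.2.2.2⟩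
    have h₃ : (p.1.1, power Ω lam ⟨p.1.1, p.2.2.1⟩) ∈
        (realFunctionOf Ω (fun ω => ω ^ lam)).graph :=
      (power Ω lam).mem_graph ⟨p.1.1, p.2.2.1⟩
    -- Two routes from `a` to `Ω^mu f(Ω) a`: through `f(Ω) a`, and through `Ω^lam a` followed by
    -- `m(Ω)`.
    have h₄ := (h.mem_graph_mul_iff (k := fun ω => ω ^ mu * f ω) (continuousOn_rpow mu)
      (fun ω _ => rfl) h₁).mpr h₂
    exact (h.mem_graph_mul_iff hm hmf h₃).mp h₄
  have hnorm : ∀ p, ‖F p‖ ≤ C * ‖e p‖ := fun p => by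
    rw [← norm_scalePower, ← norm_scalePower]
    exact h.norm_le_of_mem_graph hC hmC (hgraph p)
  -- A vector `y` of the domain is approximated by `g(Ω) y`, which lies in the core; since `Ω^lam`
  -- commutes with `g(Ω)`, the error in `K_lam` is `‖g(Ω) Ω^lam y - Ω^lam y‖`.
  have hdense : DenseRange e := by
    refine dense_closure.mp ((denseRange_toScale Ω lam).mono ?_)
    rintro _ ⟨y, rfl⟩
    rw [Metric.mem_closure_iff]
    intro ε hε
    have hy : ((y : K), power Ω lam y) ∈ (realFunctionOf Ω (fun ω => ω ^ lam)).graph :=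
      (power Ω lam).mem_graph y
    obtain ⟨g, hg, -, hlt⟩ := h.exists_realCutoff_sub_lt (power Ω lam y) hε
    have h₁ := (hT _ _).mpr (h.cutoff_mem_graph hf hg (y : K))
    obtain ⟨x, hxa, hxu⟩ : ∃ x : (power Ω lam).domain, (x : K) = realCutoff R g y ∧
        power Ω lam x = realCutoff R g (power Ω lam y) := (LinearPMap.mem_graph_iff _).mp
      (h.cutoff_apply_mem_graph (continuousOn_rpow lam) hg hy)
    have hz : realCutoff R (fun ω => g ω * f ω) y ∈ (power Ω mu).domain :=
      LinearPMap.mem_domain_of_mem_graph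
        (h.cutoff_mem_graph (continuousOn_rpow mu) (hg.mul hf) (y : K))
    let p : scaleCore Ω T lam mu := ⟨(realCutoff R g y, realCutoff R (fun ω => g ω * f ω) y),
      h₁, hxa ▸ x.2, hz⟩
    have hp : e p = toScale Ω lam x := congrArg (toScale Ω lam) (Subtype.ext hxa.symm)
    refine ⟨e p, ⟨p, rfl⟩, ?_⟩
    rw [hp, dist_comm, dist_eq_norm, ← norm_scalePower, map_sub, scalePower_toScale,
      scalePower_toScale, hxu]
    exact hlt
  -- Density and the bound `C` make `extendOfNorm` a true extension and not its default value.
  have happ : ∀ p, scaleExtend Ω T lam mu (e p) = F p :=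
    LinearMap.extendOfNorm_eq hdense ⟨C, hnorm⟩
  rw [h.mem_graph_iff]
  intro g hg
  refine hdense.induction_on (p := fun x => realCutoff R g (scalePower Ω mu
    (scaleExtend Ω T lam mu x)) = realCutoff R (fun ω => g ω * m ω) (scalePower Ω lam x)) x
    (isClosed_eq (by fun_prop) (by fun_prop)) fun p => ?_
  rw [happ]
  exact (h.mem_graph_iff _ _ _).mp (hgraph p) g hg

end Graph

section PhaseSpace

variable {K : Type*} [NormedAddCommGroup K] [InnerProductSpace ℝ K] [CompleteSpace K]
variable {Ω : K →ₗ.[ℝ] K} {R : K →L[ℝ] K}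

/-! ### The unitary group -/

/-- Euler's formula reduces the one non-real symbol to two real ones, for which the calculus on `K`
is available. -/
theorem IsPositiveResolvent.cutoffOp_mul_exp (h : IsPositiveResolvent Ω R) {g : ℝ → ℝ}
    (hg : IsCutoff g) (t : ℝ) :
    cutoffOp (complexify Ω) (fun ω => (g ω : ℂ) * Complex.exp (-(Complex.I * ω * t))) =
      cutoffCfc (complexifyCLM R) (fun ω => g ω * Real.cos (ω * t)) -
        Complex.I • cutoffCfc (complexifyCLM R) (fun ω => g ω * Real.sin (ω * t)) := by
  have hcos : Continuous fun ω : ℝ => Real.cos (ω * t) := by fun_prop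
  have hsin : Continuous fun ω : ℝ => Real.sin (ω * t) := by fun_prop
  have hc : Continuous fun r : ℂ => ((g (r.re⁻¹ - 1) * Real.cos ((r.re⁻¹ - 1) * t) : ℝ) : ℂ) :=
    Complex.continuous_ofReal.comp
      ((hg.mul hcos.continuousOn).continuous_comp.comp Complex.continuous_re)
  have hs : Continuous fun r : ℂ => ((g (r.re⁻¹ - 1) * Real.sin ((r.re⁻¹ - 1) * t) : ℝ) : ℂ) :=
    Complex.continuous_ofReal.comp
      ((hg.mul hsin.continuousOn).continuous_comp.comp Complex.continuous_re)
  have hs' : Continuous fun r : ℂ =>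
      Complex.I * ((g (r.re⁻¹ - 1) * Real.sin ((r.re⁻¹ - 1) * t) : ℝ) : ℂ) :=
    continuous_const.mul hs
  rw [← h.cutoffOp_ofReal, ← h.cutoffOp_ofReal, cutoffOp, cutoffOp, cutoffOp,
    ← cfc_const_mul Complex.I _ _ hs.continuousOn,
    ← cfc_sub _ _ _ hc.continuousOn hs'.continuousOn]
  congr 1
  ext r
  rw [show -(Complex.I * ((r.re⁻¹ - 1 : ℝ) : ℂ) * t) =
    ((-((r.re⁻¹ - 1) * t) : ℝ) : ℂ) * Complex.I by push_cast; ring, Complex.exp_mul_I,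
    ← Complex.ofReal_cos, ← Complex.ofReal_sin, Real.cos_neg, Real.sin_neg]
  push_cast
  ring

theorem IsPositiveResolvent.cutoffCfc_apply (h : IsPositiveResolvent Ω R) (g : ℝ → ℝ)
    (z : Complexification K) :
    cutoffCfc (complexifyCLM R) g z =
      Complexification.mk (realCutoff R g z.re) (realCutoff R g z.im) :=
  (h.isReal g).apply z

theorem IsPositiveResolvent.functionOf_graph (h : IsPositiveResolvent Ω R) (f : ℝ → ℂ) :
    (functionOf (complexify Ω) f).graph = functionGraph (complexify Ω) f := by
  rw [functionOf, Submodule.toLinearPMap_graph_eq]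
  rintro ⟨z, w⟩ hzw hfst
  obtain rfl : z = 0 := hfst
  have hw : ∀ g, IsCutoff g → Complexification.mk (realCutoff R g w.re) (realCutoff R g w.im) = 0 :=
      fun g hg => by
    have h₁ := hzw g hg
    rwa [h.cutoffOp_ofReal, map_zero, h.cutoffCfc_apply] at h₁
  exact Complexification.ext
    (h.eq_zero_of_realCutoff fun g hg => congrArg re (hw g hg))
    (h.eq_zero_of_realCutoff fun g hg => congrArg im (hw g hg))

/-- The real and imaginary parts of `e^{-iΩt} = cos(Ωt) - i sin(Ωt)`. -/
theorem IsPositiveResolvent.mem_unitaryGroup_graph (h : IsPositiveResolvent Ω R) (t : ℝ)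
    {a b ca sa cb sb : K}
    (hca : (a, ca) ∈ (realFunctionOf Ω (fun ω => Real.cos (ω * t))).graph)
    (hsa : (a, sa) ∈ (realFunctionOf Ω (fun ω => Real.sin (ω * t))).graph)
    (hcb : (b, cb) ∈ (realFunctionOf Ω (fun ω => Real.cos (ω * t))).graph)
    (hsb : (b, sb) ∈ (realFunctionOf Ω (fun ω => Real.sin (ω * t))).graph) :
    (Complexification.mk a b, Complexification.mk (ca + sb) (cb - sa)) ∈
      (unitaryGroup Ω t).graph := by
  rw [unitaryGroup, h.functionOf_graph]
  intro g hg
  rw [h.mem_graph_iff] at hca hsa hcb hsb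
  rw [h.cutoffOp_ofReal, h.cutoffOp_mul_exp hg, sub_apply, smul_apply, h.cutoffCfc_apply,
    h.cutoffCfc_apply, h.cutoffCfc_apply]
  ext
  · simp [hca g hg, hsb g hg]
  · simp [hsa g hg, hcb g hg]

/-! ### The operators on the phase space -/

theorem rpow_half_mul_inv {ω : ℝ} (hω : 0 < ω) :
    ω ^ (1 / 2 : ℝ) * ω⁻¹ = 1 * ω ^ (-(1 / 2) : ℝ) := by
  rw [← Real.rpow_neg_one, ← Real.rpow_add hω, one_mul]
  norm_num

theorem rpow_neg_half_mul {ω : ℝ} (hω : 0 < ω) :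
    ω ^ (-(1 / 2) : ℝ) * ω = 1 * ω ^ (1 / 2 : ℝ) := by
  nth_rewrite 2 [← Real.rpow_one ω]
  rw [← Real.rpow_add hω, one_mul]
  norm_num

/-- The multiplier of `Ω⁻¹ : K_{-1/2} → K_{1/2}` is `ω^{1/2} ω⁻¹ ω^{1/2} = 1`. With its companion
for `Ω`, this makes `J` the rotation `(u, v) ↦ (-v, u)`. -/
theorem IsPositiveResolvent.sqrtQ_complexStructure (h : IsPositiveResolvent Ω R)
    (X : PhaseSpace Ω) : sqrtQ Ω (complexStructure Ω X) = -invSqrtP Ω X := by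
  have h₁ := h.scaleExtend_mem_graph (T := Ω.inverse) (f := fun ω => ω⁻¹) (m := fun _ => 1)
    (lam := -(1 / 2)) (mu := 1 / 2) (C := 1) (fun a b => h.mem_graph_inverse_iff)
    (continuousOn_inv₀.mono fun ω hω => ne_of_gt hω) continuousOn_const zero_le_one (by simp)
    (fun ω hω => rpow_half_mul_inv hω) X.snd
  change scalePower Ω (1 / 2) (-scaleExtend Ω Ω.inverse (-(1 / 2)) (1 / 2) X.snd) = _
  rw [map_neg, h.mem_graph_one_iff.mp h₁]
  rfl

theorem IsPositiveResolvent.invSqrtP_complexStructure (h : IsPositiveResolvent Ω R)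
    (X : PhaseSpace Ω) : invSqrtP Ω (complexStructure Ω X) = sqrtQ Ω X :=
  h.mem_graph_one_iff.mp (h.scaleExtend_mem_graph (T := Ω) (f := fun ω => ω) (m := fun _ => 1)
    (lam := 1 / 2) (mu := -(1 / 2)) (C := 1) (fun a b => h.mem_graph_id_iff)
    continuousOn_id continuousOn_const zero_le_one (by simp)
    (fun ω hω => rpow_neg_half_mul hω) X.fst)

theorem IsPositiveResolvent.diagonalOp_mem_graph (h : IsPositiveResolvent Ω R) {f : ℝ → ℝ}
    (hf : Continuous f) (hf₁ : ∀ ω, |f ω| ≤ 1) (X : PhaseSpace Ω) :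
    (sqrtQ Ω X, sqrtQ Ω (diagonalOp Ω f X)) ∈ (realFunctionOf Ω f).graph ∧
      (invSqrtP Ω X, invSqrtP Ω (diagonalOp Ω f X)) ∈ (realFunctionOf Ω f).graph :=
  ⟨h.scaleExtend_mem_graph (C := 1) (fun _ _ => Iff.rfl) hf.continuousOn hf.continuousOn
      zero_le_one (fun ω _ => hf₁ ω) (fun _ _ => mul_comm _ _) X.fst,
    h.scaleExtend_mem_graph (C := 1) (fun _ _ => Iff.rfl) hf.continuousOn hf.continuousOn
      zero_le_one (fun ω _ => hf₁ ω) (fun _ _ => mul_comm _ _) X.snd⟩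

/-- The coordinates are isometric, hence injective, so identities in the phase space may be checked
in `K ⊕ K`. -/
theorem phaseSpace_ext {X Y : PhaseSpace Ω} (h₁ : sqrtQ Ω X = sqrtQ Ω Y)
    (h₂ : invSqrtP Ω X = invSqrtP Ω Y) : X = Y := by
  have hinj : ∀ lam, Function.Injective (scalePower Ω lam) := fun lam =>
    (AddMonoidHomClass.isometry_of_norm _ (norm_scalePower Ω lam)).injective
  exact (WithLp.equiv 2 _).injective (Prod.ext (hinj _ h₁) (hinj _ h₂))

theorem IsPositiveResolvent.symplecticForm_complexStructure (h : IsPositiveResolvent Ω R)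
    (X Y : PhaseSpace Ω) :
    symplecticForm Ω X (complexStructure Ω Y) =
      inner ℝ (sqrtQ Ω X) (sqrtQ Ω Y) + inner ℝ (invSqrtP Ω X) (invSqrtP Ω Y) := by
  rw [symplecticForm, h.sqrtQ_complexStructure, h.invSqrtP_complexStructure, inner_neg_left,
    sub_neg_eq_add, real_inner_comm (invSqrtP Ω X)]

theorem IsPositiveResolvent.isPositiveComplexStructure (h : IsPositiveResolvent Ω R) :
    IsPositiveComplexStructure Ω where
  sq X := by
    apply phaseSpace_ext
    · rw [h.sqrtQ_complexStructure, h.invSqrtP_complexStructure, map_neg]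
    · rw [h.invSqrtP_complexStructure, h.sqrtQ_complexStructure, map_neg]
  symplectic X Y := by
    rw [h.symplecticForm_complexStructure, h.sqrtQ_complexStructure, h.invSqrtP_complexStructure,
      symplecticForm, inner_neg_left, real_inner_comm (sqrtQ Ω Y)]
    ring
  pos X hX := by
    rw [h.symplecticForm_complexStructure]
    rcases eq_or_ne (sqrtQ Ω X) 0 with hq | hq
    · rcases eq_or_ne (invSqrtP Ω X) 0 with hp | hp
      · exact absurd (phaseSpace_ext (hq.trans (map_zero _).symm) (hp.trans (map_zero _).symm)) hX
      · exact add_pos_of_nonneg_of_pos real_inner_self_nonneg (real_inner_self_pos.mpr hp)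
    · exact add_pos_of_pos_of_nonneg (real_inner_self_pos.mpr hq) real_inner_self_nonneg

/-! ### The map onto the complexification -/

theorem zMap_re (X : PhaseSpace Ω) : (zMap Ω X).re = (1 / Real.sqrt 2) • sqrtQ Ω X := by
  rw [zMap, re_smul, Complex.ofReal_re, Complex.ofReal_im]
  simp

theorem zMap_im (X : PhaseSpace Ω) : (zMap Ω X).im = (1 / Real.sqrt 2) • invSqrtP Ω X := by
  rw [zMap, im_smul, Complex.ofReal_re, Complex.ofReal_im]
  simp

theorem zMap_add (X Y : PhaseSpace Ω) : zMap Ω (X + Y) = zMap Ω X + zMap Ω Y := by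
  ext <;> simp only [zMap_re, zMap_im, re_add, im_add, map_add, smul_add]

theorem IsPositiveResolvent.zMap_complexStructure (h : IsPositiveResolvent Ω R)
    (X : PhaseSpace Ω) : zMap Ω (complexStructure Ω X) = Complex.I • zMap Ω X := by
  ext
  · rw [zMap_re, h.sqrtQ_complexStructure, re_smul, zMap_im]
    simp
  · rw [zMap_im, h.invSqrtP_complexStructure, im_smul, zMap_re]
    simp

theorem IsPositiveResolvent.inner_zMap (h : IsPositiveResolvent Ω R) (X Y : PhaseSpace Ω) :
    inner ℂ (zMap Ω X) (zMap Ω Y) = innerPlus Ω X Y := by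
  have hsq : (1 / Real.sqrt 2) * (1 / Real.sqrt 2) = 1 / 2 := by
    rw [div_mul_div_comm, Real.mul_self_sqrt zero_le_two, one_mul]
  rw [inner_def]
  apply Complex.ext
  · rw [re_innerPlus, metricForm, h.symplecticForm_complexStructure]
    simp only [zMap_re, zMap_im, real_inner_smul_left, real_inner_smul_right, ← mul_assoc, hsq]
    ring
  · rw [im_innerPlus, symplecticForm, real_inner_comm (invSqrtP Ω X)]
    simp only [zMap_re, zMap_im, real_inner_smul_left, real_inner_smul_right, ← mul_assoc, hsq]
    ring

theorem IsPositiveResolvent.zMap_surjective (h : IsPositiveResolvent Ω R) :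
    Function.Surjective (zMap Ω) := by
  intro z
  obtain ⟨q, hq⟩ := h.scalePower_surjective (1 / 2) (Real.sqrt 2 • z.re)
  obtain ⟨p, hp⟩ := h.scalePower_surjective (-(1 / 2)) (Real.sqrt 2 • z.im)
  have hsq : (1 / Real.sqrt 2) * Real.sqrt 2 = 1 := by field_simp
  refine ⟨WithLp.toLp 2 (q, p), ?_⟩
  ext
  · rw [zMap_re]
    change (1 / Real.sqrt 2) • scalePower Ω (1 / 2) q = _
    rw [hq, smul_smul, hsq, one_smul]
  · rw [zMap_im]
    change (1 / Real.sqrt 2) • scalePower Ω (-(1 / 2)) p = _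
    rw [hp, smul_smul, hsq, one_smul]

/-- The unitary isomorphism from the phase space onto the complexification. -/
noncomputable def IsPositiveResolvent.zEquiv (h : IsPositiveResolvent Ω R) :
    ComplexPhaseSpace Ω h.isPositiveComplexStructure ≃ₗᵢ[ℂ] Complexification K :=
  LinearIsometryEquiv.ofSurjective
    (LinearMap.isometryOfInner
      { toFun := fun X : PhaseSpace Ω => zMap Ω X
        map_add' := fun X Y : PhaseSpace Ω => zMap_add X Y
        map_smul' := fun c => fun X : PhaseSpace Ω => by
          change zMap Ω (c.re • X + c.im • complexStructure Ω X) = c • zMap Ω X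
          ext
          · rw [re_smul, zMap_re, zMap_re, zMap_im, map_add, map_smul, map_smul,
              h.sqrtQ_complexStructure]
            module
          · rw [im_smul, zMap_re, zMap_im, zMap_im, map_add, map_smul, map_smul,
              h.invSqrtP_complexStructure]
            module }
      fun X Y => h.inner_zMap X Y)
    h.zMap_surjective

theorem IsPositiveResolvent.zMap_classicalFlow_mem_graph (h : IsPositiveResolvent Ω R) (t : ℝ)
    (X : PhaseSpace Ω) : (zMap Ω X, zMap Ω (classicalFlow Ω t X)) ∈ (unitaryGroup Ω t).graph := by
  have hcos := h.diagonalOp_mem_graph (f := fun ω => Real.cos (ω * t)) (by fun_prop)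
    (fun ω => Real.abs_cos_le_one _) X
  have hsin := h.diagonalOp_mem_graph (f := fun ω => Real.sin (ω * t)) (by fun_prop)
    (fun ω => Real.abs_sin_le_one _) (complexStructure Ω X)
  rw [h.sqrtQ_complexStructure, h.invSqrtP_complexStructure] at hsin
  -- The first coordinate of `J X` is `-v`; negating the pair gives `sin(Ωt) v`, which enters the
  -- real part `cos(Ωt) u + sin(Ωt) v`.
  have hsin' := Submodule.neg_mem _ hsin.1
  rw [Prod.neg_mk, neg_neg] at hsin'
  have hU := Submodule.smul_mem _ ((1 / Real.sqrt 2 : ℝ) : ℂ)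
    (h.mem_unitaryGroup_graph t hcos.1 hsin.2 hcos.2 hsin')
  convert hU using 1
  rw [Prod.smul_mk]
  refine Prod.ext ?_ ?_
  · ext
    · rw [zMap_re, re_smul, Complex.ofReal_re, Complex.ofReal_im]; simp
    · rw [zMap_im, im_smul, Complex.ofReal_re, Complex.ofReal_im]; simp
  · ext
    · rw [zMap_re, re_smul, Complex.ofReal_re, Complex.ofReal_im, classicalFlow]
      simp [sub_eq_add_neg]
    · rw [zMap_im, im_smul, Complex.ofReal_re, Complex.ofReal_im, classicalFlow]
      simp

end PhaseSpace

end OscillatorField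

theorem mainTheorem6 {K : Type*} [NormedAddCommGroup K] [InnerProductSpace ℝ K] [CompleteSpace K]
    (Ω : K →ₗ.[ℝ] K) (hself : IsSelfAdjoint Ω)
    (hpos : ∀ x : Ω.domain, 0 ≤ inner ℝ (x : K) (Ω x))
    (hker : ∀ x : Ω.domain, Ω x = 0 → x = 0) :
    ∃ hΩ : OscillatorField.IsPositiveComplexStructure Ω,
      CompleteSpace (OscillatorField.ComplexPhaseSpace Ω hΩ) ∧
      (∃ U : OscillatorField.ComplexPhaseSpace Ω hΩ ≃ₗᵢ[ℂ] OscillatorField.Complexification K,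
        ∀ X : OscillatorField.PhaseSpace Ω,
          U (OscillatorField.ComplexPhaseSpace.of hΩ X) = OscillatorField.zMap Ω X) ∧
      (∀ X : OscillatorField.PhaseSpace Ω,
        OscillatorField.zMap Ω (OscillatorField.complexStructure Ω X) =
          Complex.I • OscillatorField.zMap Ω X) ∧
      (∀ X Y : OscillatorField.PhaseSpace Ω,
        inner ℂ (OscillatorField.zMap Ω X) (OscillatorField.zMap Ω Y) =
          OscillatorField.innerPlus Ω X Y) ∧
      ∀ (t : ℝ) (X : OscillatorField.PhaseSpace Ω),
        ∃ hX : OscillatorField.zMap Ω X ∈ (OscillatorField.unitaryGroup Ω t).domain,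
          OscillatorField.zMap Ω (OscillatorField.classicalFlow Ω t X) =
            OscillatorField.unitaryGroup Ω t ⟨OscillatorField.zMap Ω X, hX⟩ := by
  obtain ⟨R, hR⟩ := OscillatorField.exists_isResolvent hself hpos
  have h : OscillatorField.IsPositiveResolvent Ω R := ⟨hself, hpos, hker, hR⟩
  refine ⟨h.isPositiveComplexStructure, ?_, ⟨h.zEquiv, fun X => rfl⟩, h.zMap_complexStructure,
    h.inner_zMap, fun t X => ?_⟩
  -- The norm here comes from `⟨·,·⟩₊`, so completeness is pulled back from the complexification.
  · exact h.zEquiv.toIsometryEquiv.completeSpace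
  · obtain ⟨⟨_, hX⟩, rfl, hz⟩ :=
      (LinearPMap.mem_graph_iff _).mp (h.zMap_classicalFlow_mem_graph t X)
    exact ⟨hX, hz.symm⟩
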